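/- Let $E$ be a real Banach space, $X$ a real Banach lattice, $1\le p\le\infty$ and $\frac1p+\frac1{p^*}=1$. Operators are bounded and linear; the dual $X^*$ of a Banach lattice carries its dual order ($x^*\ge 0$ iff $x^*(x)\ge 0$ for all $x\ge 0$). For a sequence $(u_n)$ in a Banach space $F$ put $\|(u_n)\|_p=(\sum_n\|u_n\|^p)^{1/p}$ (the supremum of the norms if $p=\infty$) and $\|(u_n)\|^w_{p}=\sup_{\|u^*\|\le1}\|(u^*(u_n))_n\|_p$ (with $u^*$ in $F^*$). For Banach spaces $F$ and Banach lattices $Y$: * for an operator $S:F\to Y$, $\widetilde\nu_p(S)$ is the infimum of $\|(u_j^*)\|_p\,\|(y_j)\|^w_{p^*}$ over all representations $S=\sum_{j=1}^\infty u_j^*\otimes y_j$ with $u_j^*\in F^*$, $0\le y_j\in Y$ and $\|(u_j^*)\|_p<\infty$, $\|(y_j)\|^w_{p^*}<\infty$; * for an operator $T:Y\to F$, $\widetilde\nu^p(T)$ is the infimum of $\|(y_j^*)\|^w_{p^*}\,\|(u_j)\|_p$ over all representations $T=\sum_{j=1}^\infty y_j^*\otimes u_j$ with $0\le y_j^*\in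 Y^*$, $u_j\in F$ and $\|(y_j^*)\|^w_{p^*}<\infty$, $\|(u_j)\|_p<\infty$. Here the series converge unconditionally in operator norm (which is automatic if $p<\infty$), and the infimum of the empty set is $\infty$. An operator $S:E\to X$ is *latticially $p$-integral* if there is a constant $C\geq 0$ with $\widetilde\nu_p(BSA)\le C\|A\|\|B\|$ for all Banach spaces $F$, all Banach lattices $Y$, all finite rank operators $A:F\to E$ and all positive finite rank operators $B:X\to Y$; $\widetilde i_p(S)$ is the infimum of such $C$. An operator $T:X\to E$ is *positively $p$-integral* if there is a constant $C>0$ with $\widetilde\nu^p(BTA)\le C\|B\|\|A\|$ for all Banach lattices $Y$, all Banach spaces $F$, all positive finite rank operators $A:Y\to X$ and all finite rank operators $B:E\to F$; $\widetilde i^p(T)$ is the infimum of such $C$. A Banach lattice $Z$ has the *positive metric approximation property* (PMAP) if for every $\varepsilon>0$ and every compact $K\subset Z$ there is a positive finite rank operator $R:Z\to Z$ with $\|R\|\le1$ and $\|Rz-z\|<\varepsilon$ for all $z\in K$. Then: (a) If $S:E\to X$ is latticially $p$-integral, then its adjoint $S^*:X^*\to E^*$ is positively $p$-integral, and $\widetilde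 i^p(S^*)\le\widetilde i_p(S)$. (b) If $T:X\to E$ is positively $p$-integral and $X^*$ has the PMAP, then its adjoint $T^*:E^*\to X^*$ is latticially $p$-integral, and $\widetilde i_p(T^*)\le\widetilde i^p(T)$. -/

import Mathlib

open scoped ENNReal NNReal

universe u

noncomputable section

namespace BanachLatticeOp

section Order

/-- The order of the dual of a Banach lattice: `f ≤ g` if and only if `f x ≤ g x` for all `x ≥ 0`. -/
instance instPartialOrderDual {X : Type u} [NormedAddCommGroup X] [NormedSpace ℝ X] [Lattice X]
    [IsOrderedAddMonoid X] : PartialOrder (StrongDual ℝ X) where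
  le f g := ∀ x : X, 0 ≤ x → f x ≤ g x
  le_refl f x _ := le_rfl
  le_trans f g h hfg hgh x hx := (hfg x hx).trans (hgh x hx)
  le_antisymm f g hfg hgf := by
    have key : ∀ x : X, 0 ≤ x → f x = g x := fun x hx => le_antisymm (hfg x hx) (hgf x hx)
    ext x
    rw [← posPart_sub_negPart x, map_sub, map_sub, key _ (posPart_nonneg x),
      key _ (negPart_nonneg x)]

end Order

section Operators

/-- The adjoint `S* : F* → E*`, `S* f = f ∘ S`. -/
def adj {E F : Type u} [NormedAddCommGroup E] [NormedSpace ℝ E] [NormedAddCommGroup F]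
    [NormedSpace ℝ F] (S : E →L[ℝ] F) : StrongDual ℝ F →L[ℝ] StrongDual ℝ E :=
  ContinuousLinearMap.precomp ℝ S

theorem adj_apply {E F : Type u} [NormedAddCommGroup E] [NormedSpace ℝ E] [NormedAddCommGroup F]
    [NormedSpace ℝ F] (S : E →L[ℝ] F) (f : StrongDual ℝ F) (x : E) : adj S f x = f (S x) := rfl

/-- `R` has finite-dimensional range. -/
def IsFiniteRank {E F : Type u} [NormedAddCommGroup E] [NormedSpace ℝ E] [NormedAddCommGroup F]
    [NormedSpace ℝ F] (R : E →L[ℝ] F) : Prop :=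
  FiniteDimensional ℝ (LinearMap.range (R : E →ₗ[ℝ] F))

/-- `R` maps the positive cone into the positive cone. -/
def IsPositiveOp {X Y : Type u} [NormedAddCommGroup X] [NormedSpace ℝ X] [PartialOrder X]
    [NormedAddCommGroup Y] [NormedSpace ℝ Y] [PartialOrder Y] (R : X →L[ℝ] Y) : Prop :=
  ∀ x : X, 0 ≤ x → 0 ≤ R x

/-- The positive metric approximation property. -/
def HasPMAP (X : Type u) [NormedAddCommGroup X] [NormedSpace ℝ X] [PartialOrder X] : Prop :=
  ∀ ε : ℝ, 0 < ε → ∀ K : Set X, IsCompact K →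
    ∃ R : X →L[ℝ] X, IsFiniteRank R ∧ IsPositiveOp R ∧ ‖R‖ ≤ 1 ∧ ∀ x ∈ K, ‖R x - x‖ < ε

end Operators

section Sequences

/-- The `l_p`-norm, in `[0, ∞]`, of a sequence of vectors: the `L_p`-norm for the counting measure
on `ℕ`. -/
def seqNorm {E : Type u} [NormedAddCommGroup E] (p : ℝ≥0∞) (v : ℕ → E) : ℝ≥0∞ :=
  MeasureTheory.eLpNorm v p MeasureTheory.Measure.count

/-- The weak `l_q`-norm, in `[0, ∞]`, of a sequence of vectors: the supremum, over the closed unit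
ball of the dual, of the `l_q`-norms of the scalar sequences `(f (v j))_j`. -/
def weakSeqNorm {E : Type u} [NormedAddCommGroup E] [NormedSpace ℝ E] (q : ℝ≥0∞) (v : ℕ → E) :
    ℝ≥0∞ :=
  ⨆ f : StrongDual ℝ E, ⨆ _ : ‖f‖ ≤ 1, seqNorm q (fun j => f (v j))

end Sequences

section Nuclear

/-- `S = ∑ u_j ⊗ x_j` (convergence in operator norm), with `(u_j) ∈ l_p(E*)`, and `(x_j)` a sequence
of positive elements in `l^w_{p*}(X)`, where `1/p + 1/p* = 1`. -/
structure IsLatticiallyNuclearRep {E X : Type u} [NormedAddCommGroup E] [NormedSpace ℝ E]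
    [NormedAddCommGroup X] [NormedSpace ℝ X] [PartialOrder X] (p : ℝ≥0∞) (S : E →L[ℝ] X)
    (u : ℕ → StrongDual ℝ E) (x : ℕ → X) : Prop where
  left_lt_top : seqNorm p u < ∞
  right_lt_top : weakSeqNorm (ENNReal.conjExponent p) x < ∞
  nonneg : ∀ j, 0 ≤ x j
  hasSum : HasSum (fun j => ContinuousLinearMap.smulRight (u j) (x j)) S

/-- The latticially `p`-nuclear norm, equal to `∞` if `S` is not latticially `p`-nuclear. -/
def latticiallyNuclearNorm {E X : Type u} [NormedAddCommGroup E] [NormedSpace ℝ E]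
    [NormedAddCommGroup X] [NormedSpace ℝ X] [PartialOrder X] (p : ℝ≥0∞) (S : E →L[ℝ] X) : ℝ≥0∞ :=
  ⨅ (u : ℕ → StrongDual ℝ E) (x : ℕ → X) (_ : IsLatticiallyNuclearRep p S u x),
    seqNorm p u * weakSeqNorm (ENNReal.conjExponent p) x

/-- `T = ∑ f_j ⊗ v_j` (convergence in operator norm), with `(f_j)` a sequence of positive functionals
in `l^w_{p*}(X*)`, and `(v_j) ∈ l_p(E)`, where `1/p + 1/p* = 1`. -/
structure IsPositivelyNuclearRep {X E : Type u} [NormedAddCommGroup X] [NormedSpace ℝ X]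
    [Lattice X] [IsOrderedAddMonoid X] [NormedAddCommGroup E] [NormedSpace ℝ E] (p : ℝ≥0∞)
    (T : X →L[ℝ] E) (f : ℕ → StrongDual ℝ X) (v : ℕ → E) : Prop where
  left_lt_top : weakSeqNorm (ENNReal.conjExponent p) f < ∞
  right_lt_top : seqNorm p v < ∞
  nonneg : ∀ j, 0 ≤ f j
  hasSum : HasSum (fun j => ContinuousLinearMap.smulRight (f j) (v j)) T

/-- The positively `p`-nuclear norm, equal to `∞` if `T` is not positively `p`-nuclear. -/
def positivelyNuclearNorm {X E : Type u} [NormedAddCommGroup X] [NormedSpace ℝ X]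
    [Lattice X] [IsOrderedAddMonoid X] [NormedAddCommGroup E] [NormedSpace ℝ E] (p : ℝ≥0∞)
    (T : X →L[ℝ] E) : ℝ≥0∞ :=
  ⨅ (f : ℕ → StrongDual ℝ X) (v : ℕ → E) (_ : IsPositivelyNuclearRep p T f v),
    weakSeqNorm (ENNReal.conjExponent p) f * seqNorm p v

end Nuclear

section Integral

/-- `C` is an admissible constant in the definition of latticially `p`-integral operators. Here `F`
runs over all Banach spaces, and `Y` over all Banach lattices. -/
def IsLatticiallyIntegralBound {E X : Type u} [NormedAddCommGroup E] [NormedSpace ℝ E]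
    [NormedAddCommGroup X] [NormedSpace ℝ X] [PartialOrder X] (p : ℝ≥0∞) (S : E →L[ℝ] X)
    (C : ℝ≥0) : Prop :=
  ∀ (F : Type u) [NormedAddCommGroup F] [NormedSpace ℝ F] [CompleteSpace F]
    (Y : Type u) [NormedAddCommGroup Y] [NormedSpace ℝ Y] [CompleteSpace Y] [Lattice Y]
    [HasSolidNorm Y] [IsOrderedAddMonoid Y] [IsOrderedModule ℝ Y]
    (A : F →L[ℝ] E) (B : X →L[ℝ] Y), IsFiniteRank A → IsFiniteRank B → IsPositiveOp B →
      latticiallyNuclearNorm p (B ∘L S ∘L A) ≤ C * ‖A‖ₑ * ‖B‖ₑ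

/-- `S` is latticially `p`-integral. -/
def IsLatticiallyIntegral {E X : Type u} [NormedAddCommGroup E] [NormedSpace ℝ E]
    [NormedAddCommGroup X] [NormedSpace ℝ X] [PartialOrder X] (p : ℝ≥0∞) (S : E →L[ℝ] X) : Prop :=
  ∃ C : ℝ≥0, IsLatticiallyIntegralBound p S C

/-- The latticially `p`-integral norm, equal to `∞` if `S` is not latticially `p`-integral. -/
def latticiallyIntegralNorm {E X : Type u} [NormedAddCommGroup E] [NormedSpace ℝ E]
    [NormedAddCommGroup X] [NormedSpace ℝ X] [PartialOrder X] (p : ℝ≥0∞) (S : E →L[ℝ] X) : ℝ≥0∞ :=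
  ⨅ (C : ℝ≥0) (_ : IsLatticiallyIntegralBound p S C), (C : ℝ≥0∞)

/-- `C` is an admissible constant in the definition of positively `p`-integral operators. Here `Y`
runs over all Banach lattices, and `F` over all Banach spaces. -/
def IsPositivelyIntegralBound {X E : Type u} [NormedAddCommGroup X] [NormedSpace ℝ X]
    [PartialOrder X] [NormedAddCommGroup E] [NormedSpace ℝ E] (p : ℝ≥0∞) (T : X →L[ℝ] E)
    (C : ℝ≥0) : Prop :=
  ∀ (Y : Type u) [NormedAddCommGroup Y] [NormedSpace ℝ Y] [CompleteSpace Y] [Lattice Y]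
    [HasSolidNorm Y] [IsOrderedAddMonoid Y] [IsOrderedModule ℝ Y]
    (F : Type u) [NormedAddCommGroup F] [NormedSpace ℝ F] [CompleteSpace F]
    (A : Y →L[ℝ] X) (B : E →L[ℝ] F), IsFiniteRank A → IsPositiveOp A → IsFiniteRank B →
      positivelyNuclearNorm p (B ∘L T ∘L A) ≤ C * ‖B‖ₑ * ‖A‖ₑ

/-- `T` is positively `p`-integral. -/
def IsPositivelyIntegral {X E : Type u} [NormedAddCommGroup X] [NormedSpace ℝ X] [PartialOrder X]
    [NormedAddCommGroup E] [NormedSpace ℝ E] (p : ℝ≥0∞) (T : X →L[ℝ] E) : Prop :=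
  ∃ C : ℝ≥0, 0 < C ∧ IsPositivelyIntegralBound p T C

/-- The positively `p`-integral norm, equal to `∞` if `T` is not positively `p`-integral. -/
def positivelyIntegralNorm {X E : Type u} [NormedAddCommGroup X] [NormedSpace ℝ X] [PartialOrder X]
    [NormedAddCommGroup E] [NormedSpace ℝ E] (p : ℝ≥0∞) (T : X →L[ℝ] E) : ℝ≥0∞ :=
  ⨅ (C : ℝ≥0) (_ : 0 < C ∧ IsPositivelyIntegralBound p T C), (C : ℝ≥0∞)

end Integral

end BanachLatticeOp

end

/-! Both halves rest on transposition. If `G` is finite-dimensional and `V : G* → H*` has a series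
`∑ u_j ⊗ x_j`, then its transpose `H → G** = G` has the series with the two factors interchanged, so
latticially nuclear representations turn into positively nuclear ones and conversely
(`positivelyNuclearNorm_transposeComp_le`, `latticiallyNuclearNorm_transposeComp_le`). What remains
is to replace operators into a bidual by operators into the space itself.

For (a), factor `B : E* → F` through its range `G`. Local reflexivity (`exists_local_reflexivity`)
replaces `B* : G* → E**` by some `V : G* → E` of almost the same norm that agrees with `B*` on the
finite-dimensional range of `S* A`. Then `B S* A` is the transpose of `A' S V`, where `A' : X → Y*`
is the restriction of `A*`, and the hypothesis on `S` applies because `Y*` is again a Banach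
lattice.

For (b), the replacement must in addition be positive. Up to a small tensor `ε φ ⊗ e`, a positive
finite rank `B : X* → Y` is a sum `∑ α_k ⊗ h_k` with positive factors
(`exists_positive_tensor_decomposition`): a finite net puts its values on the positive cone into a
finitely generated cone, and Riesz decomposition makes the nonnegative coefficients depend linearly
on the value. Such a sum factors, without loss of norm, through a coordinate lattice `G` normed by
`‖∑ |a k| • h k‖`. A Hahn-Banach argument (`exists_approx_local_reflexivity`) yields a positive `V :
G* → X` that almost agrees with the adjoint `G* → X**` on the range of `T* A`. The errors are
tensors of small functionals with positive vectors; `latticiallyNuclearNorm_add_smulRight_le`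
absorbs them in the limit. -/

noncomputable section

namespace BanachLatticeOp

set_option maxSynthPendingDepth 3
set_option linter.unusedSectionVars false

/-! ### The dual of a normed lattice as a Banach lattice (Riesz-Kantorovich) -/

section DualLattice

/-- A nonnegative element below a sum of two nonnegative elements splits accordingly. -/
theorem exists_add_of_le_add {X : Type*} [AddCommGroup X] [Lattice X] [IsOrderedAddMonoid X]
    {x y z : X} (hz : 0 ≤ z) (hx : 0 ≤ x) (hy : 0 ≤ y)
    (h : z ≤ x + y) : ∃ a b, 0 ≤ a ∧ a ≤ x ∧ 0 ≤ b ∧ b ≤ y ∧ a + b = z := by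
  refine ⟨z ⊓ x, z - z ⊓ x, le_inf hz hx, inf_le_right, sub_nonneg.2 inf_le_left, ?_, by abel⟩
  rw [sub_le_iff_le_add, ← sub_le_iff_le_add']
  refine le_inf ?_ ?_
  · exact sub_le_self _ hy
  · rwa [sub_le_iff_le_add]

variable {X : Type u} [NormedAddCommGroup X] [NormedSpace ℝ X] [Lattice X]
    [IsOrderedAddMonoid X]

instance instIsOrderedAddMonoidDual : IsOrderedAddMonoid (StrongDual ℝ X) where
  add_le_add_left f g hfg h x hx := by
    simpa using hfg x hx

instance instIsOrderedModuleDual : IsOrderedModule ℝ (StrongDual ℝ X) where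
  smul_le_smul_of_nonneg_left a ha f g hfg x hx := by
    simpa using mul_le_mul_of_nonneg_left (hfg x hx) ha
  smul_le_smul_of_nonneg_right f hf a b hab x hx := by
    simpa using mul_le_mul_of_nonneg_right hab (hf x hx)

theorem dual_mono {f : StrongDual ℝ X} (hf : 0 ≤ f) {x y : X} (hxy : x ≤ y) : f x ≤ f y := by
  have := hf (y - x) (sub_nonneg.2 hxy)
  simpa using this

variable [HasSolidNorm X]

theorem norm_le_of_nonneg_of_le {x y : X} (hx : 0 ≤ x) (hxy : x ≤ y) : ‖x‖ ≤ ‖y‖ :=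
  norm_le_norm_of_abs_le_abs (by rwa [abs_of_nonneg hx, abs_of_nonneg (hx.trans hxy)])

theorem norm_posPart_le (x : X) : ‖x⁺‖ ≤ ‖x‖ := by
  rw [← norm_abs_eq_norm x]
  exact norm_le_of_nonneg_of_le (posPart_nonneg x) (sup_le (le_abs_self x) (abs_nonneg x))

theorem norm_negPart_le (x : X) : ‖x⁻‖ ≤ ‖x‖ := by
  rw [← norm_abs_eq_norm x]
  exact norm_le_of_nonneg_of_le (negPart_nonneg x) (sup_le (neg_le_abs x) (abs_nonneg x))

/-- The value on `x ≥ 0` of the positive part of a functional. -/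
def posPartVal (f : StrongDual ℝ X) (x : X) : ℝ := sSup (f '' Set.Icc 0 x)

theorem bddAbove_image_Icc (f : StrongDual ℝ X) (x : X) : BddAbove (f '' Set.Icc 0 x) := by
  refine ⟨‖f‖ * ‖x‖, ?_⟩
  rintro _ ⟨z, ⟨hz, hzx⟩, rfl⟩
  exact (le_abs_self _).trans ((f.le_opNorm z).trans
    (mul_le_mul_of_nonneg_left (norm_le_of_nonneg_of_le hz hzx) (norm_nonneg _)))

theorem le_posPartVal (f : StrongDual ℝ X) {x z : X} (hz : 0 ≤ z) (hzx : z ≤ x) :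
    f z ≤ posPartVal f x :=
  le_csSup (bddAbove_image_Icc f x) ⟨z, ⟨hz, hzx⟩, rfl⟩

theorem posPartVal_le (f : StrongDual ℝ X) {x : X} (hx : 0 ≤ x) {c : ℝ}
    (h : ∀ z, 0 ≤ z → z ≤ x → f z ≤ c) : posPartVal f x ≤ c := by
  refine csSup_le ⟨f 0, 0, ⟨le_rfl, hx⟩, rfl⟩ ?_
  rintro _ ⟨z, ⟨hz, hzx⟩, rfl⟩
  exact h z hz hzx

theorem posPartVal_nonneg (f : StrongDual ℝ X) {x : X} (hx : 0 ≤ x) : 0 ≤ posPartVal f x := by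
  simpa using le_posPartVal f le_rfl hx

/-- Additivity on the cone is what lets the supremum extend to a functional. For `≤`, Riesz
decomposition splits each competitor below `x + y`; for `≥`, competitors are added. -/
theorem posPartVal_add (f : StrongDual ℝ X) {x y : X} (hx : 0 ≤ x) (hy : 0 ≤ y) :
    posPartVal f (x + y) = posPartVal f x + posPartVal f y := by
  apply le_antisymm
  · refine posPartVal_le f (add_nonneg hx hy) fun z hz hzxy => ?_
    obtain ⟨a, b, ha, hax, hb, hby, rfl⟩ := exists_add_of_le_add hz hx hy hzxy
    rw [map_add]
    exact add_le_add (le_posPartVal f ha hax) (le_posPartVal f hb hby)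
  · rw [← le_sub_iff_add_le]
    refine posPartVal_le f hx fun a ha hax => ?_
    rw [le_sub_comm]
    refine posPartVal_le f hy fun b hb hby => ?_
    rw [le_sub_iff_add_le', ← map_add]
    exact le_posPartVal f (add_nonneg ha hb) (add_le_add hax hby)

/-- The extension to differences of positive elements is well defined; `(x + y)⁺` need not equal `x⁺
+ y⁺`, so additivity of the extension depends on this. -/
theorem posPartVal_sub_congr (f : StrongDual ℝ X) {a b c d : X} (ha : 0 ≤ a) (hb : 0 ≤ b)
    (hc : 0 ≤ c) (hd : 0 ≤ d) (h : a - b = c - d) :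
    posPartVal f a - posPartVal f b = posPartVal f c - posPartVal f d := by
  have h1 : a + d = c + b := by
    rw [sub_eq_sub_iff_add_eq_add] at h; exact h
  have h2 := posPartVal_add f ha hd
  rw [h1, posPartVal_add f hc hb] at h2
  linarith

/-- The positive part of a functional as an additive map. -/
def posPartAddHom (f : StrongDual ℝ X) : X →+ ℝ where
  toFun x := posPartVal f x⁺ - posPartVal f x⁻
  map_zero' := by simp
  map_add' x y := by
    have : posPartVal f (x + y)⁺ - posPartVal f (x + y)⁻
        = posPartVal f (x⁺ + y⁺) - posPartVal f (x⁻ + y⁻) :=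
      posPartVal_sub_congr f (posPart_nonneg _) (negPart_nonneg _)
        (add_nonneg (posPart_nonneg _) (posPart_nonneg _))
        (add_nonneg (negPart_nonneg _) (negPart_nonneg _)) (by
          rw [posPart_sub_negPart, add_sub_add_comm, posPart_sub_negPart, posPart_sub_negPart])
    rw [this, posPartVal_add f (posPart_nonneg _) (posPart_nonneg _),
      posPartVal_add f (negPart_nonneg _) (negPart_nonneg _)]
    ring

theorem posPartVal_le_norm (f : StrongDual ℝ X) {x : X} (hx : 0 ≤ x) :
    posPartVal f x ≤ ‖f‖ * ‖x‖ :=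
  posPartVal_le f hx fun z hz hzx => (le_abs_self _).trans ((f.le_opNorm z).trans
    (mul_le_mul_of_nonneg_left (norm_le_of_nonneg_of_le hz hzx) (norm_nonneg _)))

/-- The positive part of a functional on a normed lattice. -/
def dualPosPart (f : StrongDual ℝ X) : StrongDual ℝ X :=
  -- A continuous additive map is real-linear, so homogeneity comes for free. Both values lie in
  -- `[0, ‖f‖ * ‖x‖]`, hence so does the absolute value of their difference.
  (posPartAddHom f).toRealLinearMap (AddMonoidHomClass.continuous_of_bound _ ‖f‖ fun x => by
    have h1 := posPartVal_nonneg f (posPart_nonneg x)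
    have h2 := posPartVal_nonneg f (negPart_nonneg x)
    have h3 := (posPartVal_le_norm f (posPart_nonneg x)).trans
      (mul_le_mul_of_nonneg_left (norm_posPart_le x) (norm_nonneg f))
    have h4 := (posPartVal_le_norm f (negPart_nonneg x)).trans
      (mul_le_mul_of_nonneg_left (norm_negPart_le x) (norm_nonneg f))
    change |posPartVal f x⁺ - posPartVal f x⁻| ≤ _
    rw [abs_le]
    constructor <;> linarith)

theorem dualPosPart_apply (f : StrongDual ℝ X) {x : X} (hx : 0 ≤ x) :
    dualPosPart f x = posPartVal f x := by
  change posPartVal f x⁺ - posPartVal f x⁻ = _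
  rw [posPart_of_nonneg hx, negPart_of_nonneg hx]
  have : posPartVal f (0 : X) = 0 := by
    simpa using posPartVal_add f (le_refl (0 : X)) le_rfl
  rw [this, sub_zero]

theorem dualPosPart_nonneg (f : StrongDual ℝ X) : 0 ≤ dualPosPart f := fun x hx => by
  rw [dualPosPart_apply f hx]
  exact posPartVal_nonneg f hx

theorem le_dualPosPart (f : StrongDual ℝ X) : f ≤ dualPosPart f := fun x hx => by
  rw [dualPosPart_apply f hx]
  exact le_posPartVal f hx le_rfl

theorem dualPosPart_le {f g : StrongDual ℝ X} (hg : 0 ≤ g) (hfg : f ≤ g) :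
    dualPosPart f ≤ g := fun x hx => by
  rw [dualPosPart_apply f hx]
  exact posPartVal_le f hx fun z hz hzx => (hfg z hz).trans (dual_mono hg hzx)

/-- The dual of a normed lattice is a lattice. -/
instance instLatticeDual : Lattice (StrongDual ℝ X) where
  -- The order is kept as given, so that duals can play the role of the test lattice `Y` in the
  -- definitions of integrality.
  __ := (instPartialOrderDual : PartialOrder (StrongDual ℝ X))
  sup f g := f + dualPosPart (g - f)
  inf f g := f - dualPosPart (f - g)
  le_sup_left f g := le_add_of_nonneg_right (dualPosPart_nonneg _)
  le_sup_right f g := sub_le_iff_le_add'.1 (le_dualPosPart _)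
  sup_le f g h hf hg := by
    rw [← le_sub_iff_add_le']
    exact dualPosPart_le (sub_nonneg.2 hf) (sub_le_sub_right hg f)
  inf_le_left f g := sub_le_self _ (dualPosPart_nonneg _)
  inf_le_right f g := by
    rw [sub_le_comm]
    exact le_dualPosPart _
  le_inf h f g hf hg := by
    rw [le_sub_comm]
    exact dualPosPart_le (sub_nonneg.2 hf) (sub_le_sub_left hg f)

theorem dual_apply_le_abs (f : StrongDual ℝ X) {x y : X} (hxy : |x| ≤ y) : f x ≤ |f| y := by
  have hy : 0 ≤ y := (abs_nonneg x).trans hxy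
  have h1 : f x⁺ ≤ |f| x⁺ := (le_abs_self f : f ≤ |f|) _ (posPart_nonneg x)
  have h2 : -f x⁻ ≤ |f| x⁻ := (neg_le_abs f : -f ≤ |f|) _ (negPart_nonneg x)
  have h3 : |f| |x| ≤ |f| y := dual_mono (abs_nonneg f) hxy
  rw [← posPart_add_negPart x, map_add] at h3
  calc f x = f x⁺ - f x⁻ := by rw [← map_sub, posPart_sub_negPart]
    _ ≤ |f| y := by linarith

theorem abs_dual_apply_le (f : StrongDual ℝ X) (x : X) : |f x| ≤ |f| |x| := by
  rw [abs_le]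
  have h1 := dual_apply_le_abs f (le_refl |x|)
  have h2 := dual_apply_le_abs f (x := -x) (y := |x|) (by rw [abs_neg])
  rw [map_neg] at h2
  constructor <;> linarith

/-- Unfolding `|f| = f ⊔ -f` leaves two facts about positive parts: homogeneity for the factor 2,
and `f⁺ = f + (-f)⁺`, which is the commutativity of `f ⊔ 0`. -/
theorem dual_abs_eq (f : StrongDual ℝ X) : |f| = (2 : ℝ) • dualPosPart f - f := by
  have h : |f| = f + dualPosPart (-f - f) := rfl
  have h2 : dualPosPart (-f - f) = (2 : ℝ) • dualPosPart (-f) := by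
    apply le_antisymm
    · refine dualPosPart_le (smul_nonneg zero_le_two (dualPosPart_nonneg _)) ?_
      have := smul_le_smul_of_nonneg_left (le_dualPosPart (-f)) (zero_le_two (α := ℝ))
      rwa [two_smul ℝ (-f), ← sub_eq_add_neg] at this
    · have h3 : dualPosPart (-f) ≤ (1 / 2 : ℝ) • dualPosPart (-f - f) := by
        refine dualPosPart_le (smul_nonneg (by norm_num) (dualPosPart_nonneg _)) ?_
        have := smul_le_smul_of_nonneg_left (le_dualPosPart (-f - f))
          (show (0 : ℝ) ≤ 1 / 2 by norm_num)
        refine le_trans (le_of_eq ?_) this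
        module
      have := smul_le_smul_of_nonneg_left h3 (zero_le_two (α := ℝ))
      refine this.trans (le_of_eq ?_)
      module
  have h4 : dualPosPart f = f + dualPosPart (-f) := by
    have h5 : f ⊔ 0 = f + dualPosPart (0 - f) := rfl
    have h6 : (0 : StrongDual ℝ X) ⊔ f = 0 + dualPosPart (f - 0) := rfl
    rw [zero_sub] at h5
    rw [sub_zero, zero_add] at h6
    rw [← h6, ← h5, sup_comm]
  rw [h, h2, h4]
  module

/-- For `0 ≤ z ≤ x` the element `2z - x` lies between `-x` and `x`. Estimating `f` there, instead of
at `z`, gives the constant 1 that solidity of the dual norm requires. -/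
theorem norm_dual_abs_apply_le (f : StrongDual ℝ X) {x : X} (hx : 0 ≤ x) :
    |f| x ≤ ‖f‖ * ‖x‖ := by
  have h : dualPosPart f x ≤ (‖f‖ * ‖x‖ + f x) / 2 := by
    rw [dualPosPart_apply f hx]
    refine posPartVal_le f hx fun z hz hzx => ?_
    have h1 : ‖(2 : ℝ) • z - x‖ ≤ ‖x‖ := by
      refine norm_le_norm_of_abs_le_abs ?_
      rw [abs_of_nonneg hx, abs_le', two_smul]
      constructor
      · rw [sub_le_iff_le_add]
        exact add_le_add hzx hzx
      · rw [neg_sub]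
        exact sub_le_self _ (add_nonneg hz hz)
    have h2 := (le_abs_self _).trans ((f.le_opNorm ((2 : ℝ) • z - x)).trans
      (mul_le_mul_of_nonneg_left h1 (norm_nonneg f)))
    rw [map_sub, map_smul, smul_eq_mul] at h2
    linarith
  rw [dual_abs_eq]
  simp only [sub_apply, smul_apply, smul_eq_mul]
  linarith

instance instHasSolidNormDual : HasSolidNorm (StrongDual ℝ X) where
  solid f g hfg := by
    refine f.opNorm_le_bound (norm_nonneg g) fun x => ?_
    calc |f x| ≤ |f| |x| := abs_dual_apply_le f x
      _ ≤ |g| |x| := hfg _ (abs_nonneg x)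
      _ ≤ ‖g‖ * ‖|x|‖ := norm_dual_abs_apply_le g (abs_nonneg x)
      _ = ‖g‖ * ‖x‖ := by rw [norm_abs_eq_norm]

end DualLattice

/-! ### Local reflexivity, exact and relative to a cone -/

section LocalReflexivity

open scoped Pointwise

variable {E : Type*} [NormedAddCommGroup E] [NormedSpace ℝ E]

theorem exists_apply_le_neg_mul_norm_add (f : StrongDual ℝ E) {r η : ℝ} (hr : 0 ≤ r)
    (hη : 0 < η) : ∃ y : E, ‖y‖ ≤ r ∧ f y ≤ -(r * ‖f‖) + η := by
  by_contra! h
  have h0 : 0 < r * ‖f‖ - η := by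
    have := h 0 (by simpa using hr)
    rw [map_zero] at this
    linarith
  have hr' : 0 < r := by
    rcases hr.eq_or_lt with rfl | h'
    · rw [zero_mul] at h0; linarith
    · exact h'
  have key : ‖f‖ ≤ (r * ‖f‖ - η) / r := by
    refine ContinuousLinearMap.opNorm_le_of_unit_norm (div_nonneg h0.le hr) fun x hx => ?_
    rw [le_div_iff₀ hr', Real.norm_eq_abs]
    have h1 := h (r • x) (by rw [norm_smul, hx, mul_one, Real.norm_of_nonneg hr])
    have h2 := h (-(r • x)) (by rw [norm_neg, norm_smul, hx, mul_one, Real.norm_of_nonneg hr])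
    rw [map_neg] at h2
    rw [map_smul, smul_eq_mul] at h1 h2
    rcases abs_cases (f x) with ⟨h3, -⟩ | ⟨h3, -⟩ <;> rw [h3] <;> nlinarith
  rw [le_div_iff₀ hr'] at key
  linarith

/-- Minimizing over a product of balls decouples into the coordinates, and the infimum of `f c` on
the ball of radius `r` is `-(r * ‖f c‖)`. -/
theorem mul_sum_norm_le_of_forall_le_sum {C : Type*} [Fintype C] (f : C → StrongDual ℝ E)
    {r m : ℝ} (hr : 0 ≤ r) (h : ∀ y : C → E, (∀ c, ‖y c‖ ≤ r) → m ≤ ∑ c, f c (y c)) :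
    r * ∑ c, ‖f c‖ ≤ -m := by
  refine le_of_forall_pos_le_add fun ε hε => ?_
  have hη : 0 < ε / (Fintype.card C + 1) := by positivity
  choose y hy hfy using fun c => exists_apply_le_neg_mul_norm_add (f c) hr hη
  have h1 := (h y hy).trans (Finset.sum_le_sum fun c _ => hfy c)
  rw [Finset.sum_add_distrib, Finset.sum_const, Finset.card_univ, nsmul_eq_mul,
    Finset.sum_neg_distrib, ← Finset.mul_sum] at h1
  have h2 : (Fintype.card C : ℝ) * (ε / (Fintype.card C + 1)) ≤ ε := by
    rw [mul_div_assoc', div_le_iff₀ (by positivity)]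
    nlinarith
  linarith

/-- Finitely many elements of the bidual that are nonnegative with respect to a cone can be
approximated on finitely many functionals by elements of the cone, with control of the norms of
finitely many linear combinations. -/
theorem exists_mem_cone_approx_bidual {κ C I : Type*} [Fintype κ] [Fintype C] [Fintype I]
    (P : PointedCone ℝ E) (w : κ → StrongDual ℝ (StrongDual ℝ E))
    (hw : ∀ k (f : StrongDual ℝ E), (∀ x ∈ P, 0 ≤ f x) → 0 ≤ w k f) (γ : C → κ → ℝ) {r : ℝ}
    (hr : 0 ≤ r) (hγ : ∀ c, ‖∑ k, γ c k • w k‖ ≤ r) (n : I → StrongDual ℝ E) {ε : ℝ}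
    (hε : 0 < ε) :
    ∃ x : κ → E, (∀ k, x k ∈ P) ∧ (∀ c, ‖∑ k, γ c k • x k‖ ≤ r + ε) ∧
      ∀ i k, |n i (x k) - w k (n i)| ≤ ε := by
  classical
  let Ψ : (κ → E) →ₗ[ℝ] (C → E) × (I → κ → ℝ) :=
    { toFun := fun x => (fun c => ∑ k, γ c k • x k, fun i k => n i (x k))
      map_add' := fun x y => by
        ext <;> simp [Finset.sum_add_distrib]
      map_smul' := fun a x => by
        ext <;> simp [Finset.smul_sum, smul_comm a] }
  let t : I → κ → ℝ := fun i k => w k (n i)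
  -- Differences between what families in the cone attain and what is wanted: combinations in the
  -- `r`-ball and the prescribed values `t`. The claim follows once `0` is in the closure of this
  -- convex set.
  let D : Set ((C → E) × (I → κ → ℝ)) :=
    Ψ '' (Set.univ.pi fun _ => (P : Set E)) - (Set.univ.pi fun _ : C => Metric.closedBall (0 : E) r) ×ˢ {t}
  have hD : Convex ℝ D := by
    refine Convex.sub (Convex.linear_image (convex_pi fun _ _ => ?_) Ψ)
      (Convex.prod (convex_pi fun _ _ => convex_closedBall _ _) (convex_singleton _))
    exact (P : ConvexCone ℝ E).convex
  have hmem : ∀ x : κ → E, (∀ k, x k ∈ P) → ∀ y : C → E, (∀ c, ‖y c‖ ≤ r) → Ψ x - (y, t) ∈ D :=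
    fun x hx y hy => Set.sub_mem_sub ⟨x, fun k _ => hx k, rfl⟩
      ⟨fun c _ => mem_closedBall_zero_iff.2 (hy c), rfl⟩
  by_cases h0 : (0 : (C → E) × (I → κ → ℝ)) ∈ closure D
  · obtain ⟨d, hd, hdε⟩ := Metric.mem_closure_iff.1 h0 ε hε
    obtain ⟨_, ⟨x, hx, rfl⟩, ⟨y, t'⟩, ⟨hy, rfl⟩, rfl⟩ := hd
    rw [dist_zero_left] at hdε
    refine ⟨x, fun k => hx k trivial, fun c => ?_, fun i k => ?_⟩
    · have h1 : ‖∑ k, γ c k • x k - y c‖ ≤ ε :=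
        (norm_le_pi_norm (Ψ x - (y, t)).1 c).trans ((norm_fst_le _).trans hdε.le)
      have h2 : ‖y c‖ ≤ r := mem_closedBall_zero_iff.1 (hy c trivial)
      calc ‖∑ k, γ c k • x k‖ = ‖y c + (∑ k, γ c k • x k - y c)‖ := by rw [add_sub_cancel]
        _ ≤ r + ε := (norm_add_le _ _).trans (add_le_add h2 h1)
    · exact (norm_le_pi_norm ((Ψ x - (y, t)).2 i) k).trans
        ((norm_le_pi_norm (Ψ x - (y, t)).2 i).trans ((norm_snd_le _).trans hdε.le))
  · exfalso
    obtain ⟨f, u, hf, hu⟩ := geometric_hahn_banach_closed_point hD.closure isClosed_closure h0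
    rw [map_zero] at hu
    let ψ : C → StrongDual ℝ E := fun c =>
      f ∘L ContinuousLinearMap.inl ℝ (C → E) (I → κ → ℝ) ∘L
        ContinuousLinearMap.single ℝ (fun _ : C => E) c
    let l : I → κ → ℝ := fun i k => f (0, Pi.single i (Pi.single k 1))
    have hfs : ∀ y s, f (y, s) = ∑ c, ψ c (y c) + ∑ i, ∑ k, s i k * l i k := by
      intro y s
      have h1 : (y, s) = ∑ c, ((Pi.single c (y c) : C → E), (0 : I → κ → ℝ)) +
          ∑ i, ∑ k, s i k • ((0 : C → E), (Pi.single i (Pi.single k 1) : I → κ → ℝ)) := by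
        ext c
        · simp [Prod.fst_sum, Finset.sum_apply, Pi.single_apply]
        · simp [Prod.snd_sum, Finset.sum_apply, Pi.single_apply, apply_ite]
      rw [h1, map_add, map_sum, map_sum]
      congr 1
      refine Finset.sum_congr rfl fun i _ => ?_
      rw [map_sum]
      exact Finset.sum_congr rfl fun k _ => by rw [map_smul, smul_eq_mul]
    have hlt : ∀ x : κ → E, (∀ k, x k ∈ P) → ∀ y : C → E, (∀ c, ‖y c‖ ≤ r) →
        f (Ψ x) - f (y, t) < u := fun x hx y hy => by
      rw [← map_sub]; exact hf _ (subset_closure (hmem x hx y hy))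
    -- On the cone `f ∘ Ψ` is bounded above, hence nonpositive by scaling.
    have hcone : ∀ x : κ → E, (∀ k, x k ∈ P) → f (Ψ x) ≤ 0 := by
      intro x hx
      by_contra! hpos
      have hc : 0 ≤ |u + f (0, t)| / f (Ψ x) := by positivity
      have h1 := hlt ((|u + f (0, t)| / f (Ψ x)) • x)
        (fun k => P.smul_mem hc (hx k)) 0 (fun c => by simpa using hr)
      rw [map_smul, map_smul, smul_eq_mul, div_mul_cancel₀ _ hpos.ne'] at h1
      linarith [le_abs_self (u + f (0, t))]
    -- Testing `hcone` on families with one nonzero entry shows that `-(∑ γ c k • ψ c + ∑ l i k • n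
    -- i)` is nonnegative on `P`, so the positivity of `w k` applies to it.
    have hk : ∀ k, ∑ c, γ c k * w k (ψ c) + ∑ i, l i k * w k (n i) ≤ 0 := by
      intro k
      have h1 := hw k (-(∑ c, γ c k • ψ c + ∑ i, l i k • n i)) fun x hx => by
        have h2 := hcone (Pi.single k x) fun j => by
          by_cases hj : j = k
          · subst hj; simpa using hx
          · simp [Pi.single_eq_of_ne hj]
        have h3 : Ψ (Pi.single k x) =
            (fun c => γ c k • x, fun i => Pi.single k (n i x)) := by
          ext c j
          · simp [Ψ, Pi.single_apply]
          · by_cases hj : j = k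
            · subst hj; simp [Ψ]
            · simp [Ψ, Pi.single_eq_of_ne hj]
        rw [h3, hfs] at h2
        simp only [map_smul, smul_eq_mul, Pi.single_apply, ite_mul, zero_mul, Finset.sum_ite_eq',
          Finset.mem_univ, if_true] at h2
        simp only [neg_apply, add_apply, sum_apply, smul_apply, smul_eq_mul, Left.nonneg_neg_iff]
        simpa only [mul_comm] using h2
      simp only [map_neg, map_add, map_sum, map_smul, smul_eq_mul] at h1
      linarith
    have hsum : ∑ c, (∑ k, γ c k • w k) (ψ c) + ∑ i, ∑ k, t i k * l i k ≤ 0 := by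
      have h1 := Finset.sum_nonpos fun k (_ : k ∈ Finset.univ) => hk k
      rw [Finset.sum_add_distrib, Finset.sum_comm,
        Finset.sum_comm (f := fun k i => l i k * w k (n i))] at h1
      simp only [sum_apply, smul_apply, smul_eq_mul, t]
      simpa only [mul_comm (l _ _)] using h1
    -- The family `x = 0` gives `r * ∑ ‖ψ c‖ ≤ u + ∑ t * l`. With `hsum` and `hlow` this forces `0 ≤
    -- u`, against `u < 0`.
    have hψ := mul_sum_norm_le_of_forall_le_sum ψ (m := -u - ∑ i, ∑ k, t i k * l i k) hr
      fun y hy => by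
        have h1 := hlt 0 (fun k => P.zero_mem) y hy
        rw [map_zero, map_zero, hfs] at h1
        linarith
    have hlow : -(r * ∑ c, ‖ψ c‖) ≤ ∑ c, (∑ k, γ c k • w k) (ψ c) := by
      rw [Finset.mul_sum, ← Finset.sum_neg_distrib]
      refine Finset.sum_le_sum fun c _ => ?_
      have h1 := ((∑ k, γ c k • w k).le_opNorm (ψ c)).trans
        (mul_le_mul_of_nonneg_right (hγ c) (norm_nonneg _))
      rw [Real.norm_eq_abs] at h1
      linarith [neg_abs_le ((∑ k, γ c k • w k) (ψ c))]
    linarith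

/-- Approximate local reflexivity relative to a cone. -/
theorem exists_approx_local_reflexivity {G κ I : Type*} [NormedAddCommGroup G] [NormedSpace ℝ G]
    [Fintype κ] [Fintype I] (b : Module.Basis κ ℝ G) (P : PointedCone ℝ E)
    (W : G →L[ℝ] StrongDual ℝ (StrongDual ℝ E))
    (hW : ∀ k (f : StrongDual ℝ E), (∀ x ∈ P, 0 ≤ f x) → 0 ≤ W (b k) f)
    (n : I → StrongDual ℝ E) {ε : ℝ} (hε : 0 < ε) :
    ∃ V : G →L[ℝ] E, (∀ k, V (b k) ∈ P) ∧ ‖V‖ ≤ ‖W‖ + ε ∧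
      ∀ i k, |n i (V (b k)) - W (b k) (n i)| ≤ ε := by
  have : FiniteDimensional ℝ G := b.finiteDimensional_of_finite
  have : ProperSpace G := FiniteDimensional.proper ℝ G
  -- Chosen so that `‖W‖ + ε / 2 = (‖W‖ + ε) * (1 - δ)`: the left side bounds `V` on a `δ`-net of
  -- the unit ball, and passing from the net to the ball costs `‖V‖ * δ`.
  set δ : ℝ := (ε / 2) / (‖W‖ + ε) with hδ
  have hWε : 0 < ‖W‖ + ε := by positivity
  have hδ0 : 0 < δ := by positivity
  have hδ1 : δ * (‖W‖ + ε) = ε / 2 := div_mul_cancel₀ _ hWε.ne'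
  have hδ2 : δ < 1 := by
    rw [hδ, div_lt_one hWε]
    linarith [norm_nonneg W]
  obtain ⟨s, hs, hsfin, hcov⟩ := Metric.finite_approx_of_totallyBounded
    (isCompact_closedBall (0 : G) 1).totallyBounded δ hδ0
  have : Fintype s := hsfin.fintype
  have hexp : ∀ g, W g = ∑ k, b.repr g k • W (b k) := fun g => by
    conv_lhs => rw [← b.sum_repr g, map_sum]
    simp only [map_smul]
  obtain ⟨x, hxP, hxγ, hxn⟩ := exists_mem_cone_approx_bidual P (fun k => W (b k)) hW
    (fun (c : s) k => b.repr (c : G) k) (norm_nonneg W) (fun c => by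
      rw [← hexp]
      exact W.unit_le_opNorm _ (mem_closedBall_zero_iff.1 (hs c.2))) n (half_pos hε)
  set V : G →L[ℝ] E := (b.constr ℝ x).toContinuousLinearMap with hV
  have hVb : ∀ k, V (b k) = x k := b.constr_basis ℝ x
  have hVs : ∀ c ∈ s, ‖V c‖ ≤ ‖W‖ + ε / 2 := fun c hc => by
    have h1 := hxγ ⟨c, hc⟩
    have h2 : V c = ∑ k, b.repr c k • x k := by
      conv_lhs => rw [← b.sum_repr c, map_sum]
      simp only [map_smul, hVb]
    rwa [h2]
  refine ⟨V, fun k => by rw [hVb]; exact hxP k, ?_, fun i k => ?_⟩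
  · have h1 : ‖V‖ ≤ ‖W‖ + ε / 2 + ‖V‖ * δ := by
      refine ContinuousLinearMap.opNorm_le_of_unit_norm (by positivity) fun g hg => ?_
      obtain ⟨c, hc, hgc⟩ := Set.mem_iUnion₂.1 (hcov (mem_closedBall_zero_iff.2 hg.le))
      have h2 : ‖g - c‖ ≤ δ := by
        rw [← dist_eq_norm]; exact (Metric.mem_ball.1 hgc).le
      calc ‖V g‖ = ‖V c + V (g - c)‖ := by rw [← map_add, add_sub_cancel]
        _ ≤ ‖V c‖ + ‖V (g - c)‖ := norm_add_le _ _
        _ ≤ _ := add_le_add (hVs c hc) ((V.le_opNorm _).trans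
          (mul_le_mul_of_nonneg_left h2 (norm_nonneg _)))
    have h2 : ‖V‖ * (1 - δ) ≤ (‖W‖ + ε) * (1 - δ) := by linarith
    exact le_of_mul_le_mul_right h2 (by linarith)
  · rw [hVb]
    exact (hxn i k).trans (by linarith)

/-- If the joint evaluation `E → ℝ^I` were not onto, a nonzero functional vanishing on its range
would be a linear relation among the `n i`. -/
theorem exists_biorthogonal {I : Type*} [Fintype I] [DecidableEq I] {n : I → StrongDual ℝ E}
    (hn : LinearIndependent ℝ n) : ∃ e : I → E, ∀ i j, n i (e j) = if i = j then 1 else 0 := by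
  let Φ : E →ₗ[ℝ] (I → ℝ) := LinearMap.pi fun i => (n i : E →ₗ[ℝ] ℝ)
  have hΦ : LinearMap.range Φ = ⊤ := by
    by_contra hne
    obtain ⟨f, hf, hle⟩ := Submodule.exists_le_ker_of_lt_top _ (lt_top_iff_ne_top.2 hne)
    apply hf
    have h1 : ∑ i, f (Pi.single i 1) • n i = 0 := by
      ext x
      have h2 : f (Φ x) = 0 := hle ⟨x, rfl⟩
      rw [← Finset.univ_sum_single (Φ x), map_sum] at h2
      simp only [sum_apply, smul_apply, smul_eq_mul, zero_apply]
      rw [← h2]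
      refine Finset.sum_congr rfl fun i _ => ?_
      have h3 : (Pi.single i (Φ x i) : I → ℝ) = (n i x) • Pi.single i 1 := by
        rw [← Pi.single_smul]; simp [Φ]
      rw [h3, map_smul, smul_eq_mul, mul_comm]
    have h4 := Fintype.linearIndependent_iff.1 hn _ h1
    refine LinearMap.pi_ext' fun i => LinearMap.ext_ring ?_
    simpa using h4 i
  have h : ∀ j, ∃ x, Φ x = Pi.single j 1 := fun j => LinearMap.range_eq_top.1 hΦ _
  choose e he using h
  refine ⟨e, fun i j => ?_⟩
  have := congrFun (he j) i
  simpa [Φ, Pi.single_apply] using this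

/-- Local reflexivity: an operator from a finite-dimensional space into the bidual of `E` agrees on
a finite-dimensional space of functionals with an operator into `E` of almost the same norm. -/
theorem exists_local_reflexivity {G : Type*} [NormedAddCommGroup G] [NormedSpace ℝ G]
    [FiniteDimensional ℝ G] (W : G →L[ℝ] StrongDual ℝ (StrongDual ℝ E))
    (N : Submodule ℝ (StrongDual ℝ E)) [FiniteDimensional ℝ N] {ε : ℝ} (hε : 0 < ε) :
    ∃ V : G →L[ℝ] E, ‖V‖ ≤ ‖W‖ + ε ∧ ∀ g, ∀ n ∈ N, n (V g) = W g n := by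
  let b := Module.finBasis ℝ G
  let m := Module.finBasis ℝ N
  obtain ⟨e, he⟩ := exists_biorthogonal (n := fun i => (m i : StrongDual ℝ E))
    (m.linearIndependent.map' N.subtype N.ker_subtype)
  let φ := fun k => (b.coord k).toContinuousLinearMap
  set K : ℝ := ∑ k, ∑ i, ‖φ k‖ * ‖e i‖ with hK
  have hK0 : 0 ≤ K := by positivity
  -- The defects `d k i` are corrected by tensors `φ k ⊗ e i` of total norm at most `K` times the
  -- tolerance, so tolerance and correction add up to `ε`. The correction may have any sign, so this
  -- works only without a cone constraint.
  have hδ : 0 < ε / (1 + K) := by positivity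
  obtain ⟨V, -, hV, hVn⟩ := exists_approx_local_reflexivity b ⊤ W (fun k f hf => by
    have : f = 0 := by
      ext x
      have h1 := hf x trivial
      have h2 := hf (-x) trivial
      rw [map_neg] at h2
      simpa using le_antisymm (by linarith) h1
    rw [this, map_zero]) (fun i => (m i : StrongDual ℝ E)) hδ
  set d : Fin _ → Fin _ → ℝ := fun k i => W (b k) (m i) - (m i : StrongDual ℝ E) (V (b k)) with hd
  refine ⟨V + ∑ k, ∑ i, d k i • (φ k).smulRight (e i), ?_, fun g n hn => ?_⟩
  · have h1 : ‖∑ k, ∑ i, d k i • (φ k).smulRight (e i)‖ ≤ ε / (1 + K) * K := by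
      rw [hK, Finset.mul_sum]
      refine norm_sum_le_of_le _ fun k _ => ?_
      rw [Finset.mul_sum]
      refine norm_sum_le_of_le _ fun i _ => ?_
      rw [norm_smul, ContinuousLinearMap.norm_smulRight_apply]
      refine mul_le_mul_of_nonneg_right ?_ (by positivity)
      rw [Real.norm_eq_abs, hd, abs_sub_comm]
      exact hVn i k
    have h2 : ε / (1 + K) + ε / (1 + K) * K = ε := by field_simp
    linarith [norm_add_le V (∑ k, ∑ i, d k i • (φ k).smulRight (e i))]
  · have hbasis : ∀ k i, (m i : StrongDual ℝ E)
        ((V + ∑ k, ∑ i, d k i • (φ k).smulRight (e i)) (b k)) = W (b k) (m i) := by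
      intro k i
      have hφ : ∀ k', φ k' (b k) = if k = k' then 1 else 0 := fun k' => by
        simp [φ, Finsupp.single_apply]
      simp only [add_apply, sum_apply, smul_apply, ContinuousLinearMap.smulRight_apply, map_add,
        map_sum, map_smul, hφ, he, smul_eq_mul]
      simp [hd]
    have h1 : ∀ i, (m i : StrongDual ℝ E) ∘L (V + ∑ k, ∑ i, d k i • (φ k).smulRight (e i)) =
        W.flip (m i) := fun i => by
      apply ContinuousLinearMap.coe_injective
      exact b.ext fun k => hbasis k i
    obtain ⟨c, rfl⟩ : ∃ c : Fin _ → ℝ, n = ∑ i, c i • (m i : StrongDual ℝ E) := by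
      refine ⟨fun i => m.repr ⟨n, hn⟩ i, ?_⟩
      have h : ((∑ i, m.repr ⟨n, hn⟩ i • m i : N) : StrongDual ℝ E) = n := by rw [m.sum_repr]
      rw [Submodule.coe_sum] at h
      exact h.symm
    have h2 : ∀ i, (m i : StrongDual ℝ E)
        ((V + ∑ k, ∑ i, d k i • (φ k).smulRight (e i)) g) = W g (m i) := fun i =>
      DFunLike.congr_fun (h1 i) g
    rw [map_sum, sum_apply]
    refine Finset.sum_congr rfl fun i _ => ?_
    rw [smul_apply, map_smul, h2]

end LocalReflexivity

/-! ### Riesz decomposition and positive factorization of maps from coordinate spaces -/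

section RieszDecomposition

variable {Y : Type*} [AddCommGroup Y] [Lattice Y] [IsOrderedAddMonoid Y]

theorem exists_eq_sum_of_le_sum {ι : Type*} (s : Finset ι) {x : ι → Y} (hx : ∀ i, 0 ≤ x i) :
    ∀ {z : Y}, 0 ≤ z → z ≤ ∑ i ∈ s, x i →
      ∃ w : ι → Y, (∀ i, 0 ≤ w i) ∧ (∀ i, w i ≤ x i) ∧ ∑ i ∈ s, w i = z := by
  classical
  induction s using Finset.induction_on with
  | empty =>
    intro z hz hzx
    exact ⟨0, fun _ => le_rfl, hx, by simpa using le_antisymm hz hzx⟩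
  | insert a s ha ih =>
    intro z hz hzx
    rw [Finset.sum_insert ha] at hzx
    obtain ⟨c, d, hc, hca, hd, hds, rfl⟩ :=
      exists_add_of_le_add hz (hx a) (Finset.sum_nonneg fun i _ => hx i) hzx
    obtain ⟨w, hw, hwx, rfl⟩ := ih hd hds
    refine ⟨Function.update w a c, fun i => ?_, fun i => ?_, ?_⟩
    · by_cases h : i = a
      · subst h; simpa using hc
      · simpa [h] using hw i
    · by_cases h : i = a
      · subst h; simpa using hca
      · simpa [h] using hwx i
    · rw [Finset.sum_insert ha, Function.update_self]
      congr 1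
      exact Finset.sum_congr rfl fun i hi =>
        Function.update_of_ne (by rintro rfl; exact ha hi) _ _

/-- The Riesz decomposition property for two finite families of the same sum. -/
theorem exists_common_refinement {ι κ : Type*} [Fintype κ] (s : Finset ι) {x : ι → Y}
    (hx : ∀ i, 0 ≤ x i) : ∀ {y : κ → Y}, (∀ k, 0 ≤ y k) → ∑ i ∈ s, x i = ∑ k, y k →
      ∃ z : ι → κ → Y, (∀ i k, 0 ≤ z i k) ∧ (∀ i ∈ s, ∑ k, z i k = x i) ∧
        ∀ k, ∑ i ∈ s, z i k = y k := by
  classical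
  induction s using Finset.induction_on with
  | empty =>
    intro y hy h
    refine ⟨fun _ _ => 0, fun _ _ => le_rfl, by simp, fun k => ?_⟩
    rw [Finset.sum_empty] at h ⊢
    exact ((Finset.sum_eq_zero_iff_of_nonneg fun k _ => hy k).1 h.symm k (Finset.mem_univ k)).symm
  | insert a s ha ih =>
    intro y hy h
    rw [Finset.sum_insert ha] at h
    obtain ⟨w, hw, hwy, hwa⟩ := exists_eq_sum_of_le_sum Finset.univ hy (hx a)
      (h ▸ le_add_of_nonneg_right (Finset.sum_nonneg fun i _ => hx i))
    obtain ⟨z, hz, hzx, hzy⟩ := ih (y := fun k => y k - w k) (fun k => sub_nonneg.2 (hwy k))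
      (by rw [Finset.sum_sub_distrib, hwa, ← h, add_sub_cancel_left])
    refine ⟨Function.update z a w, fun i k => ?_, fun i hi => ?_, fun k => ?_⟩
    · by_cases h : i = a
      · subst h; simpa using hw k
      · simpa [h] using hz i k
    · by_cases h : i = a
      · subst h; simpa using hwa
      · simpa [h] using hzx i (Finset.mem_of_mem_insert_of_ne hi h)
    · have : ∑ i ∈ s, Function.update z a w i k = ∑ i ∈ s, z i k :=
        Finset.sum_congr rfl fun i hi => by
          rw [Function.update_of_ne (by rintro rfl; exact ha hi)]
      rw [Finset.sum_insert ha, this, hzy, Function.update_self, add_sub_cancel]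

variable [Module ℝ Y] [IsOrderedModule ℝ Y]

/-- A positive linear map from a coordinate space to a vector lattice factors through positive
linear maps in such a way that the first one kills a given vector of the kernel. -/
theorem exists_positive_factorization_of_sum_eq_zero {κ : Type} [Fintype κ] {h : κ → Y}
    (hh : ∀ k, 0 ≤ h k) {a : κ → ℝ} (ha : ∑ k, a k • h k = 0) :
    ∃ (κ' : Type) (_ : Fintype κ') (h' : κ' → Y) (θ : (κ → ℝ) →ₗ[ℝ] (κ' → ℝ)),
      (∀ k, 0 ≤ h' k) ∧ (∀ v, 0 ≤ v → 0 ≤ θ v) ∧ (∀ v, ∑ k, θ v k • h' k = ∑ k, v k • h k) ∧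
        θ a = 0 := by
  classical
  -- The relation says that the families `a⁺ • h` and `a⁻ • h` have the same sum. A common
  -- refinement `z k l` has rows summing to the first and columns to the second.
  have hpn : ∑ k, (a k)⁺ • h k = ∑ k, (a k)⁻ • h k := by
    rw [← sub_eq_zero, ← Finset.sum_sub_distrib, ← ha]
    exact Finset.sum_congr rfl fun k _ => by rw [← sub_smul, posPart_sub_negPart]
  obtain ⟨z, hz, hzr, hzc⟩ := exists_common_refinement Finset.univ
    (fun k => smul_nonneg (posPart_nonneg (a k)) (hh k))
    (fun k => smul_nonneg (negPart_nonneg (a k)) (hh k)) hpn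
  have hz0 : ∀ k l, ¬ 0 < a k → z k l = 0 := fun k l hk => by
    have h1 := hzr k (Finset.mem_univ k)
    rw [posPart_eq_zero.2 (not_lt.1 hk), zero_smul] at h1
    exact (Finset.sum_eq_zero_iff_of_nonneg fun l _ => hz k l).1 h1 l (Finset.mem_univ l)
  have hz1 : ∀ k l, ¬ a l < 0 → z k l = 0 := fun k l hl => by
    have h1 := hzc l
    rw [negPart_eq_zero.2 (not_lt.1 hl), zero_smul] at h1
    exact (Finset.sum_eq_zero_iff_of_nonneg fun k _ => hz k l).1 h1 k (Finset.mem_univ k)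
  -- The new generators are the `h k` with `a k = 0` and the pieces `z k l`. Each remaining `h k` is
  -- its row or column sum divided by `|a k|`; at `(k, l)` the vector `a` then contributes `1 - 1 =
  -- 0`.
  let θ : (κ → ℝ) →ₗ[ℝ] (κ ⊕ κ × κ → ℝ) :=
    { toFun := fun v => Sum.elim (fun k => if a k = 0 then v k else 0)
        (fun kl => if 0 < a kl.1 ∧ a kl.2 < 0 then v kl.1 / a kl.1 + v kl.2 / (-a kl.2) else 0)
      map_add' := fun v w => by
        ext (k | kl)
        · simp only [Sum.elim_inl, Pi.add_apply]; split_ifs <;> simp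
        · simp only [Sum.elim_inr, Pi.add_apply]; split_ifs <;> ring
      map_smul' := fun c v => by
        ext (k | kl)
        · simp
        · simp only [Sum.elim_inr, Pi.smul_apply, smul_eq_mul, RingHom.id_apply]
          split_ifs <;> ring }
  refine ⟨κ ⊕ κ × κ, inferInstance, Sum.elim h fun kl => z kl.1 kl.2, θ, ?_, ?_, ?_, ?_⟩
  · rintro (k | kl)
    · exact hh k
    · exact hz _ _
  · rintro v hv (k | kl)
    · change 0 ≤ if a k = 0 then v k else 0
      split_ifs
      exacts [hv k, le_rfl]
    · change 0 ≤ if 0 < a kl.1 ∧ a kl.2 < 0 then v kl.1 / a kl.1 + v kl.2 / (-a kl.2) else 0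
      split_ifs with h0
      · exact add_nonneg (div_nonneg (hv _) h0.1.le)
          (div_nonneg (hv _) (neg_nonneg.2 h0.2.le))
      · exact le_rfl
  · intro v
    have hterm : ∀ k l, (θ v (Sum.inr (k, l))) • z k l =
        (v k / a k) • z k l + (v l / (-a l)) • z k l := fun k l => by
      change (if 0 < a k ∧ a l < 0 then v k / a k + v l / (-a l) else 0) • z k l = _
      split_ifs with h0
      · rw [add_smul]
      · have : z k l = 0 := by
          by_cases hk : 0 < a k
          · exact hz1 k l fun hl => h0 ⟨hk, hl⟩
          · exact hz0 k l hk
        simp [this]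
    have hrow : ∀ k, ∑ l, (v k / a k) • z k l = (v k / a k) • ((a k)⁺ • h k) := fun k => by
      rw [← Finset.smul_sum, hzr k (Finset.mem_univ k)]
    have hcol : ∀ l, ∑ k, (v l / (-a l)) • z k l = (v l / (-a l)) • ((a l)⁻ • h l) := fun l => by
      rw [← Finset.smul_sum, hzc l]
    rw [Fintype.sum_sum_type, Fintype.sum_prod_type]
    simp only [Sum.elim_inl, Sum.elim_inr, hterm, Finset.sum_add_distrib]
    rw [Finset.sum_comm (f := fun k l => (v l / (-a l)) • z k l)]
    simp only [hrow, hcol]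
    rw [← Finset.sum_add_distrib, ← Finset.sum_add_distrib]
    refine Finset.sum_congr rfl fun k _ => ?_
    change (if a k = 0 then v k else 0) • h k + _ = _
    simp only [smul_smul, ← add_smul]
    congr 1
    rcases lt_trichotomy (a k) 0 with h0 | h0 | h0
    · rw [if_neg h0.ne, posPart_eq_zero.2 h0.le, negPart_eq_neg.2 h0.le]
      have := h0.ne
      field_simp
      ring
    · simp [h0]
    · rw [if_neg h0.ne', negPart_eq_zero.2 h0.le, posPart_eq_self.2 h0.le]
      have := h0.ne'
      field_simp
      ring
  · ext (k | kl)
    · change (if a k = 0 then a k else 0) = 0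
      split_ifs with h0
      exacts [h0, rfl]
    · change (if 0 < a kl.1 ∧ a kl.2 < 0 then a kl.1 / a kl.1 + a kl.2 / (-a kl.2) else 0) = 0
      split_ifs with h0
      · rw [div_self h0.1.ne', div_neg, div_self h0.2.ne, add_neg_cancel]
      · rfl

/-- A positive linear map from a coordinate space to a vector lattice factors through positive
linear maps in such a way that the first one has the same kernel. -/
theorem exists_positive_factorization_ker {J : Type} [Fintype J] {q : J → Y}
    (hq : ∀ j, 0 ≤ q j) :
    ∃ (κ : Type) (_ : Fintype κ) (h : κ → Y) (θ : (J → ℝ) →ₗ[ℝ] (κ → ℝ)),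
      (∀ k, 0 ≤ h k) ∧ (∀ v, 0 ≤ v → 0 ≤ θ v) ∧ (∀ v, ∑ k, θ v k • h k = ∑ j, v j • q j) ∧
        ∀ v, ∑ j, v j • q j = 0 → θ v = 0 := by
  classical
  let Φ : (J → ℝ) →ₗ[ℝ] Y := Fintype.linearCombination ℝ q
  have hΦ : ∀ v, Φ v = ∑ j, v j • q j := fun v => Fintype.linearCombination_apply ℝ q v
  -- Finitely many kernel vectors are killed one at a time: the image of a kernel vector is again a
  -- relation among the current generators, and composing further keeps the earlier ones killed.
  have key : ∀ S : Finset (J → ℝ), (∀ v ∈ S, Φ v = 0) →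
      ∃ (κ : Type) (_ : Fintype κ) (h : κ → Y) (θ : (J → ℝ) →ₗ[ℝ] (κ → ℝ)),
        (∀ k, 0 ≤ h k) ∧ (∀ v, 0 ≤ v → 0 ≤ θ v) ∧ (∀ v, ∑ k, θ v k • h k = ∑ j, v j • q j) ∧
          ∀ v ∈ S, θ v = 0 := by
    intro S
    induction S using Finset.induction_on with
    | empty =>
      exact fun _ => ⟨J, inferInstance, q, LinearMap.id, hq, fun v hv => hv, fun v => rfl, by simp⟩
    | insert a S ha ih =>
      intro hS
      obtain ⟨κ, _, h, θ, hh, hθ, hθq, hθS⟩ := ih fun v hv => hS v (Finset.mem_insert_of_mem hv)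
      obtain ⟨κ', _, h', θ', hh', hθ', hθq', hθa⟩ :=
        exists_positive_factorization_of_sum_eq_zero hh (a := θ a)
          (by rw [hθq, ← hΦ, hS a (Finset.mem_insert_self a S)])
      refine ⟨κ', inferInstance, h', θ' ∘ₗ θ, hh', fun v hv => hθ' _ (hθ v hv), fun v => ?_, ?_⟩
      · rw [LinearMap.comp_apply, hθq', hθq]
      · intro v hv
        rcases Finset.mem_insert.1 hv with rfl | hv
        · exact hθa
        · rw [LinearMap.comp_apply, hθS v hv, map_zero]
  obtain ⟨S, hS⟩ := (inferInstance : Module.Finite ℝ (LinearMap.ker Φ)).fg_top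
  obtain ⟨κ, i, h, θ, hh, hθ, hθq, hθS⟩ := key (S.image (LinearMap.ker Φ).subtype) (by
    intro v hv
    obtain ⟨w, -, rfl⟩ := Finset.mem_image.1 hv
    exact w.2)
  refine ⟨κ, i, h, θ, hh, hθ, hθq, fun v hv => ?_⟩
  have h1 : (⊤ : Submodule ℝ (LinearMap.ker Φ)) ≤
      LinearMap.ker (θ ∘ₗ (LinearMap.ker Φ).subtype) := by
    rw [← hS, Submodule.span_le]
    intro w hw
    exact hθS _ (Finset.mem_image_of_mem _ hw)
  exact h1 (x := ⟨v, by rw [LinearMap.mem_ker, hΦ, hv]⟩) trivial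

end RieszDecomposition

/-! ### Positive finite rank operators as sums of positive tensors -/

section PositiveFiniteRank

variable {Z Y : Type u} [NormedAddCommGroup Z] [NormedSpace ℝ Z] [Lattice Z] [IsOrderedAddMonoid Z]
  [HasSolidNorm Z] [NormedAddCommGroup Y] [NormedSpace ℝ Y] [Lattice Y] [IsOrderedAddMonoid Y]
  [IsOrderedModule ℝ Y]

/-- Up to an arbitrarily small positive operator of rank one, a positive operator of finite rank is
a finite sum of tensors of positive functionals and positive elements. -/
theorem exists_positive_tensor_decomposition {B : Z →L[ℝ] Y} (hB : IsFiniteRank B)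
    (hBpos : IsPositiveOp B) :
    ∃ (φ : StrongDual ℝ Z) (e : Y), 0 ≤ φ ∧ 0 ≤ e ∧ ∀ ε : ℝ, 0 < ε →
      ∃ (κ : Type u) (_ : Fintype κ) (α : κ → StrongDual ℝ Z) (h : κ → Y), (∀ k, 0 ≤ α k) ∧
        (∀ k, 0 < h k) ∧ ∀ z, ∑ k, α k z • h k = B z + (ε * φ z) • e := by
  classical
  have : FiniteDimensional ℝ (LinearMap.range (B : Z →ₗ[ℝ] Y)) := hB
  let b := Module.finBasis ℝ (LinearMap.range (B : Z →ₗ[ℝ] Y))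
  let n := Module.finrank ℝ (LinearMap.range (B : Z →ₗ[ℝ] Y))
  let β : Fin n → StrongDual ℝ Z := fun i => (b.coord i).toContinuousLinearMap ∘L
    B.codRestrict (LinearMap.range (B : Z →ₗ[ℝ] Y)) fun z => ⟨z, rfl⟩
  have hβ : ∀ z, ∑ i, β i z • (b i : Y) = B z := fun z => by
    have h := congrArg (LinearMap.range (B : Z →ₗ[ℝ] Y)).subtype
      (b.sum_repr (B.codRestrict (LinearMap.range (B : Z →ₗ[ℝ] Y)) (fun z => ⟨z, rfl⟩) z))
    rw [map_sum] at h
    exact h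
  set φ : StrongDual ℝ Z := ∑ i, |β i| with hφ
  set e : Y := ∑ i, |(b i : Y)| with he
  have hφ0 : 0 ≤ φ := Finset.sum_nonneg fun i _ => abs_nonneg (β i)
  have hβφ : ∀ i z, 0 ≤ z → |β i z| ≤ φ z := fun i z hz => by
    have h1 : |β i z| ≤ |β i| z := by
      have := abs_dual_apply_le (β i) z
      rwa [abs_of_nonneg hz] at this
    have h2 : |β i| ≤ φ :=
      Finset.single_le_sum (f := fun i => |β i|) (fun i _ => abs_nonneg (β i)) (Finset.mem_univ i)
    exact h1.trans (h2 z hz)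
  refine ⟨φ, e, hφ0, Finset.sum_nonneg fun i _ => abs_nonneg _, fun ε hε => ?_⟩
  -- Coordinates of the positive elements of the range inside the unit cube. For `z ≥ 0` with `φ z ≠
  -- 0` the coordinates of `B z / φ z` lie here, so a finite net in `D` supplies almost all of a
  -- generating cone.
  let D : Set (Fin n → ℝ) := {c | 0 ≤ ∑ i, c i • (b i : Y) ∧ ∀ i, |c i| ≤ 1}
  have hD : TotallyBounded D :=
    (isCompact_closedBall (0 : Fin n → ℝ) 1).totallyBounded.subset fun c hc =>
      mem_closedBall_zero_iff.2 ((pi_norm_le_iff_of_nonneg zero_le_one).2 hc.2)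
  obtain ⟨T, hTD, hTfin, hT⟩ := Metric.finite_approx_of_totallyBounded hD ε hε
  have : Fintype T := hTfin.fintype
  let q : T ⊕ (Fin n ⊕ Fin n) → Y := Sum.elim (fun c => ∑ i, (c : Fin n → ℝ) i • (b i : Y))
    (Sum.elim (fun i => (b i : Y)⁺) fun i => (b i : Y)⁻)
  have hq : ∀ j, 0 ≤ q j := by
    rintro (c | i | i)
    · exact (hTD c.2).1
    · exact posPart_nonneg _
    · exact negPart_nonneg _
  have hrep : ∀ z, 0 ≤ z → ∃ v : T ⊕ (Fin n ⊕ Fin n) → ℝ, 0 ≤ v ∧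
      ∑ j, v j • q j = B z + (ε * φ z) • e := by
    intro z hz
    rcases (show (0 : ℝ) ≤ φ z from hφ0 z hz).eq_or_lt with h0 | h0
    · refine ⟨0, le_rfl, ?_⟩
      have h1 : B z = 0 := by
        rw [← hβ]
        refine Finset.sum_eq_zero fun i _ => ?_
        have h2 := hβφ i z hz
        rw [← h0, abs_nonpos_iff] at h2
        rw [h2, zero_smul]
      simp [h1, ← h0]
    · set τ := φ z
      have hc : (fun i => τ⁻¹ * β i z) ∈ D := by
        constructor
        · have : ∑ i, (τ⁻¹ * β i z) • (b i : Y) = τ⁻¹ • B z := by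
            rw [← hβ, Finset.smul_sum]
            simp only [smul_smul]
          rw [this]
          exact smul_nonneg (inv_nonneg.2 h0.le) (hBpos z hz)
        · intro i
          rw [abs_mul, abs_of_pos (inv_pos.2 h0), inv_mul_le_iff₀ h0, mul_one]
          exact hβφ i z hz
      obtain ⟨c, hcT, hcd⟩ := Set.mem_iUnion₂.1 (hT hc)
      set r : Fin n → ℝ := fun i => τ⁻¹ * β i z - c i with hr
      have hrε : ∀ i, |r i| ≤ ε := fun i =>
        (dist_le_pi_dist (fun i => τ⁻¹ * β i z) c i).trans (Metric.mem_ball.1 hcd).le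
      -- The error `r` of the net is made positive by the added `ε |b i|`: `r b + ε |b| = (ε + r) b⁺
      -- + (ε - r) b⁻`.
      refine ⟨τ • Sum.elim (Pi.single ⟨c, hcT⟩ 1)
        (Sum.elim (fun i => ε + r i) fun i => ε - r i), smul_nonneg h0.le ?_, ?_⟩
      · rintro (c' | i | i)
        · change 0 ≤ (Pi.single (⟨c, hcT⟩ : T) (1 : ℝ) : T → ℝ) c'
          rw [Pi.single_apply]
          split_ifs <;> norm_num
        · change 0 ≤ ε + r i
          linarith [neg_abs_le (r i), hrε i]
        · change 0 ≤ ε - r i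
          linarith [le_abs_self (r i), hrε i]
      · simp only [Pi.smul_apply, smul_assoc, ← Finset.smul_sum, Fintype.sum_sum_type,
          Sum.elim_inl, Sum.elim_inr, q]
        have h1 : ∑ c' : T, (Pi.single (⟨c, hcT⟩ : T) (1 : ℝ) : T → ℝ) c' •
            ∑ i, (c' : Fin n → ℝ) i • (b i : Y) = ∑ i, c i • (b i : Y) := by
          rw [Finset.sum_eq_single_of_mem ⟨c, hcT⟩ (Finset.mem_univ _)]
          · simp
          · intro c' _ hc'
            rw [Pi.single_eq_of_ne hc', zero_smul]
        rw [h1, ← Finset.sum_add_distrib, ← Finset.sum_add_distrib, mul_comm ε, mul_smul, ← hβ, he]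
        have h2 : ∀ i, c i • (b i : Y) + ((ε + r i) • (b i : Y)⁺ + (ε - r i) • (b i : Y)⁻) =
            τ⁻¹ • (β i z • (b i : Y)) + ε • |(b i : Y)| := fun i => by
          have h3 : (τ⁻¹ * β i z) • (b i : Y) = c i • (b i : Y) + r i • (b i : Y) := by
            rw [← add_smul, hr]; congr 1; ring
          rw [← mul_smul, h3, ← posPart_add_negPart (b i : Y)]
          have h4 : r i • (b i : Y) = r i • ((b i : Y)⁺ - (b i : Y)⁻) := by
            rw [posPart_sub_negPart]
          rw [h4]
          module
        simp only [h2, Finset.sum_add_distrib, ← Finset.smul_sum]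
        rw [smul_add, smul_inv_smul₀ h0.ne']
  obtain ⟨κ, _, h, θ, hh, hθ, hθq, hθker⟩ := exists_positive_factorization_ker hq
  let Φ : (T ⊕ (Fin n ⊕ Fin n) → ℝ) →ₗ[ℝ] Y := Fintype.linearCombination ℝ q
  have hΦ : ∀ v, Φ v = ∑ j, v j • q j := fun v => Fintype.linearCombination_apply ℝ q v
  obtain ⟨σ, hσ⟩ := Φ.rangeRestrict.exists_rightInverse_of_surjective Φ.range_rangeRestrict
  have hσΦ : ∀ y, Φ (σ y) = y := fun y => congrArg Subtype.val (LinearMap.congr_fun hσ y)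
  -- As `θ` kills the kernel of `Φ`, it descends to the range of `Φ`. Positivity of `α k` can then
  -- be read off the nonnegative representative from `hrep`, although the linear section `σ` need
  -- not be positive.
  have hθσ : ∀ v, θ (σ ⟨Φ v, v, rfl⟩) = θ v := fun v => by
    rw [← sub_eq_zero, ← map_sub]
    refine hθker _ ?_
    rw [← hΦ, map_sub, hσΦ, sub_self]
  let Bε : Z →L[ℝ] Y := B + (ε • φ).smulRight e
  have hBε : ∀ z, Bε z = B z + (ε * φ z) • e := fun z => rfl
  have hmem : ∀ z, Bε z ∈ LinearMap.range Φ := fun z => by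
    have hpos : ∀ z, 0 ≤ z → Bε z ∈ LinearMap.range Φ := fun z hz => by
      obtain ⟨v, -, hv⟩ := hrep z hz
      exact ⟨v, by rw [hΦ, hv, hBε]⟩
    rw [← posPart_sub_negPart z, map_sub]
    exact Submodule.sub_mem _ (hpos _ (posPart_nonneg z)) (hpos _ (negPart_nonneg z))
  let α : κ → StrongDual ℝ Z := fun k =>
    (LinearMap.proj k ∘ₗ θ ∘ₗ σ).toContinuousLinearMap ∘L Bε.codRestrict (LinearMap.range Φ) hmem
  have hα : ∀ k z, α k z = θ (σ ⟨Bε z, hmem z⟩) k := fun k z => rfl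
  have hsum : ∀ z, ∑ k, α k z • h k = B z + (ε * φ z) • e := fun z => by
    simp only [hα]
    rw [hθq, ← hΦ, hσΦ]
    exact hBε z
  -- Zero generators are discarded, since strict positivity is what makes the norm of `AbsSumSpace`
  -- definite.
  refine ⟨ULift.{u} {k // h k ≠ 0}, inferInstance, fun k => α k.down, fun k => h k.down,
    fun k z hz => ?_, fun k => lt_of_le_of_ne (hh _) k.down.2.symm, fun z => ?_⟩
  · obtain ⟨v, hv, hvz⟩ := hrep z hz
    have h1 : (⟨Bε z, hmem z⟩ : LinearMap.range Φ) = ⟨Φ v, v, rfl⟩ :=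
      Subtype.ext ((hBε z).trans (hvz.symm.trans (hΦ v).symm))
    change 0 ≤ α k.down z
    rw [hα, h1, hθσ]
    exact hθ v hv _
  · rw [← hsum z, ← Equiv.ulift.symm.sum_comp]
    change ∑ k : {k // h k ≠ 0}, α k z • h k = _
    rw [← Finset.sum_subtype (Finset.univ.filter fun k => h k ≠ 0) (by simp)
      fun k => α k z • h k]
    exact Finset.sum_filter_of_ne fun k _ hk h0 => hk (by rw [h0, smul_zero])

end PositiveFiniteRank

/-! ### Strong and weak `l_p`-norms: prepending a term, scaling, contractions -/

section SequenceNorms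

open MeasureTheory

variable {E F : Type u} [NormedAddCommGroup E] [NormedAddCommGroup F]

theorem seqNorm_mono (p : ℝ≥0∞) {u : ℕ → E} {v : ℕ → F} (h : ∀ j, ‖u j‖ ≤ ‖v j‖) :
    seqNorm p u ≤ seqNorm p v :=
  eLpNorm_mono h

/-- The sequence `a, u 0, u 1, …`. -/
def consSeq {α : Type*} (a : α) (u : ℕ → α) : ℕ → α
  | 0 => a
  | j + 1 => u j

theorem seqNorm_consSeq_le {p : ℝ≥0∞} (hp : 1 ≤ p) (a : E) (u : ℕ → E) :
    seqNorm p (consSeq a u) ≤ ‖a‖ₑ + seqNorm p u := by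
  have hsplit : consSeq a u = Set.indicator {0} (fun _ => a) + consSeq 0 u := by
    ext (_ | j) <;> simp [consSeq]
  -- The successor map carries counting measure to its restriction to the positive integers, where
  -- the shifted sequence is supported; this treats all `p` at once.
  have hshift : eLpNorm (consSeq 0 u) p Measure.count = eLpNorm u p Measure.count := by
    have hemb : MeasurableEmbedding Nat.succ :=
      .of_measurable_inverse (g := Nat.pred) (measurable_of_countable _)
        (MeasurableSet.of_discrete) (measurable_of_countable _) fun _ => rfl
    have hmap : Measure.map Nat.succ Measure.count =
        (Measure.count : Measure ℕ).restrict (Set.range Nat.succ) := by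
      rw [← hemb.map_comap]
      congr 1
      ext s hs
      rw [hemb.comap_apply, Measure.count_apply hs,
        Measure.count_apply (MeasurableSet.of_discrete), Nat.succ_injective.encard_image]
    rw [← eLpNorm_restrict_eq_of_support_subset (s := Set.range Nat.succ), ← hmap,
      hemb.eLpNorm_map_measure]
    · rfl
    · rintro (_ | j) hj
      · exact absurd rfl hj
      · exact ⟨j, rfl⟩
  calc seqNorm p (consSeq a u)
      ≤ eLpNorm (Set.indicator {0} fun _ => a) p Measure.count
          + eLpNorm (consSeq 0 u) p Measure.count := by
        rw [hsplit]
        exact eLpNorm_add_le .of_discrete .of_discrete hp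
    _ ≤ ‖a‖ₑ + seqNorm p u := by
        rw [hshift]
        refine add_le_add ((eLpNorm_indicator_const_le a p).trans ?_) le_rfl
        simp

variable [NormedSpace ℝ E] [NormedSpace ℝ F]

theorem seqNorm_const_smul (p : ℝ≥0∞) (t : ℝ≥0) (u : ℕ → E) :
    seqNorm p (fun j => t • u j) = t * seqNorm p u := by
  have := eLpNorm_const_smul (t : ℝ) u p Measure.count
  rw [Real.enorm_of_nonneg (NNReal.coe_nonneg t), ENNReal.ofReal_coe_nnreal] at this
  exact this

theorem weakSeqNorm_consSeq_le {q : ℝ≥0∞} (hq : 1 ≤ q) (a : E) (u : ℕ → E) :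
    weakSeqNorm q (consSeq a u) ≤ ‖a‖ₑ + weakSeqNorm q u := by
  refine iSup₂_le fun f hf => ?_
  have h1 : (fun j => f (consSeq a u j)) = consSeq (f a) fun j => f (u j) := by
    ext (_ | j) <;> rfl
  rw [h1]
  refine (seqNorm_consSeq_le hq _ _).trans (add_le_add ?_ (le_iSup₂_of_le f hf le_rfl))
  refine enorm_le_iff_norm_le.2 ((f.le_opNorm a).trans ?_)
  exact mul_le_of_le_one_left (norm_nonneg a) hf

theorem weakSeqNorm_const_smul (q : ℝ≥0∞) (t : ℝ≥0) (u : ℕ → E) :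
    weakSeqNorm q (fun j => t • u j) = t * weakSeqNorm q u := by
  simp only [weakSeqNorm, ENNReal.mul_iSup, ← seqNorm_const_smul]
  congr! 6 with f hf
  exact (f : E →ₗ[ℝ] ℝ).map_smul_of_tower t _

theorem weakSeqNorm_map_le (q : ℝ≥0∞) {L : E →L[ℝ] F} (hL : ‖L‖ ≤ 1) (u : ℕ → E) :
    weakSeqNorm q (fun j => L (u j)) ≤ weakSeqNorm q u := by
  refine iSup₂_le fun f hf => le_iSup₂_of_le (f ∘L L) ?_ le_rfl
  exact (f.opNorm_comp_le L).trans (mul_le_one₀ hf (norm_nonneg _) hL)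

theorem one_le_conjExponent (p : ℝ≥0∞) : 1 ≤ ENNReal.conjExponent p :=
  le_self_add

end SequenceNorms

/-! ### Perturbing the latticially nuclear norm by rank one tensors -/

section LatticiallyNuclear

variable {E Y : Type u} [NormedAddCommGroup E] [NormedSpace ℝ E] [NormedAddCommGroup Y]
  [NormedSpace ℝ Y] [PartialOrder Y]

theorem IsLatticiallyNuclearRep.consSeq {p : ℝ≥0∞} (hp : 1 ≤ p) {S : E →L[ℝ] Y}
    {u : ℕ → StrongDual ℝ E} {x : ℕ → Y} (hS : IsLatticiallyNuclearRep p S u x)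
    (v : StrongDual ℝ E) {h : Y} (hh : 0 ≤ h) :
    IsLatticiallyNuclearRep p (S + v.smulRight h) (consSeq v u) (consSeq h x) where
  left_lt_top := (seqNorm_consSeq_le hp v u).trans_lt
    (ENNReal.add_lt_top.2 ⟨enorm_lt_top, hS.left_lt_top⟩)
  right_lt_top := (weakSeqNorm_consSeq_le (one_le_conjExponent p) h x).trans_lt
    (ENNReal.add_lt_top.2 ⟨enorm_lt_top, hS.right_lt_top⟩)
  nonneg := by
    rintro (_ | j)
    exacts [hh, hS.nonneg j]
  hasSum := by
    have := (hasSum_nat_add_iff (f := fun j => ContinuousLinearMap.smulRight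
      (BanachLatticeOp.consSeq v u j) (BanachLatticeOp.consSeq h x j)) 1).1 hS.hasSum
    rwa [Finset.sum_range_one] at this

theorem IsLatticiallyNuclearRep.smul [IsOrderedAddMonoid Y] [IsOrderedModule ℝ Y] {p : ℝ≥0∞}
    {S : E →L[ℝ] Y} {u : ℕ → StrongDual ℝ E} {x : ℕ → Y} (hS : IsLatticiallyNuclearRep p S u x)
    {t : ℝ≥0} (ht : t ≠ 0) :
    IsLatticiallyNuclearRep p S (fun j => t • u j) (fun j => t⁻¹ • x j) where
  left_lt_top := by
    rw [seqNorm_const_smul]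
    exact ENNReal.mul_lt_top ENNReal.coe_lt_top hS.left_lt_top
  right_lt_top := by
    rw [weakSeqNorm_const_smul]
    exact ENNReal.mul_lt_top ENNReal.coe_lt_top hS.right_lt_top
  nonneg j := by
    rw [NNReal.smul_def]
    exact smul_nonneg (NNReal.coe_nonneg t⁻¹) (hS.nonneg j)
  hasSum := by
    convert hS.hasSum using 2 with j
    ext z
    have ht' : (t : ℝ) ≠ 0 := by exact_mod_cast ht
    simp only [ContinuousLinearMap.smulRight_apply, smul_apply, NNReal.smul_def, NNReal.coe_inv,
      smul_eq_mul, smul_smul]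
    congr 1
    field_simp

theorem latticiallyNuclearNorm_le {p : ℝ≥0∞} {S : E →L[ℝ] Y} {u : ℕ → StrongDual ℝ E} {x : ℕ → Y}
    (hS : IsLatticiallyNuclearRep p S u x) :
    latticiallyNuclearNorm p S ≤ seqNorm p u * weakSeqNorm (ENNReal.conjExponent p) x :=
  iInf_le_of_le u (iInf_le_of_le x (iInf_le _ hS))

/-- Rescaling balances a product bounded by `c ^ 2`, making each factor at most `c`. The natural
choice is `t = c / U`; for `U = 0` any large `t` serves. -/
theorem exists_mul_le_and_inv_mul_le {U W : ℝ≥0∞} (hU : U < ∞) (hW : W < ∞) {c : ℝ≥0}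
    (hc : 0 < c) (h : U * W ≤ c ^ 2) : ∃ t : ℝ≥0, t ≠ 0 ∧ t * U ≤ c ∧ (t⁻¹ : ℝ≥0) * W ≤ c := by
  lift U to ℝ≥0 using hU.ne
  lift W to ℝ≥0 using hW.ne
  norm_cast at h ⊢
  rcases eq_or_ne U 0 with rfl | hU0
  · refine ⟨W / c + 1, by positivity, by simp, ?_⟩
    rw [inv_mul_le_iff₀ (by positivity), add_mul, one_mul, div_mul_cancel₀ _ hc.ne']
    exact le_self_add
  · refine ⟨c / U, by positivity, (div_mul_cancel₀ _ hU0).le, ?_⟩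
    rw [inv_mul_le_iff₀ (by positivity), div_mul_eq_mul_div, le_div_iff₀ (by positivity)]
    rwa [mul_comm, ← sq]

variable [IsOrderedAddMonoid Y] [IsOrderedModule ℝ Y]

/-- Balance a near-optimal representation of `S` to factors at most about `c`, and `v ⊗ h` to
factors at most about `d`; prepending adds the factor norms. The square-root form is not sharp, but
suffices because `d` will tend to `0`. -/
theorem latticiallyNuclearNorm_add_smulRight_le {p : ℝ≥0∞} (hp : 1 ≤ p) {S : E →L[ℝ] Y}
    {v : StrongDual ℝ E} {h : Y} (hh : 0 ≤ h) {c d : ℝ≥0}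
    (hS : latticiallyNuclearNorm p S ≤ c ^ 2) (hv : ‖v‖ₑ * ‖h‖ₑ ≤ d ^ 2) :
    latticiallyNuclearNorm p (S + v.smulRight h) ≤ (c + d) ^ 2 := by
  -- The slack `δ` is needed twice: the infimum may not be attained, and balancing requires a
  -- positive bound.
  have key : ∀ δ : ℝ≥0, 0 < δ → latticiallyNuclearNorm p (S + v.smulRight h) ≤
      (((c + δ + (d + δ)) ^ 2 : ℝ≥0) : ℝ≥0∞) := by
    intro δ hδ
    have hlt : ∀ a : ℝ≥0, (a : ℝ≥0∞) ^ 2 < ((a + δ : ℝ≥0) : ℝ≥0∞) ^ 2 := fun a => by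
      norm_cast
      exact pow_lt_pow_left₀ (lt_add_of_pos_right a hδ) a.2 two_ne_zero
    have h1 := hS.trans_lt (hlt c)
    simp only [latticiallyNuclearNorm, iInf_lt_iff] at h1
    obtain ⟨u, x, hrep, hux⟩ := h1
    obtain ⟨t, ht, htu, htx⟩ := exists_mul_le_and_inv_mul_le hrep.left_lt_top hrep.right_lt_top
      (add_pos_of_nonneg_of_pos c.2 hδ) hux.le
    obtain ⟨s, hs, hsv, hsh⟩ := exists_mul_le_and_inv_mul_le enorm_lt_top enorm_lt_top
      (add_pos_of_nonneg_of_pos d.2 hδ) (hv.trans (hlt d).le)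
    have hvh : v.smulRight h = (s • v).smulRight (s⁻¹ • h) := by
      ext z
      have hs' : (s : ℝ) ≠ 0 := by exact_mod_cast hs
      simp only [ContinuousLinearMap.smulRight_apply, smul_apply, NNReal.smul_def, NNReal.coe_inv,
        smul_eq_mul, smul_smul]
      congr 1
      field_simp
    have henorm : ∀ {V : Type u} [NormedAddCommGroup V] [NormedSpace ℝ V] (r : ℝ≥0) (w : V),
        ‖r • w‖ₑ = r * ‖w‖ₑ := fun r w => by
      rw [NNReal.smul_def, enorm_smul, Real.enorm_of_nonneg (NNReal.coe_nonneg r), ENNReal.ofReal_coe_nnreal]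
    rw [hvh]
    have hsh0 : (0 : Y) ≤ s⁻¹ • h := by
      rw [NNReal.smul_def]
      exact smul_nonneg (NNReal.coe_nonneg s⁻¹) hh
    refine (latticiallyNuclearNorm_le ((hrep.smul ht).consSeq hp (s • v) hsh0)).trans ?_
    rw [sq, ENNReal.coe_mul, ENNReal.coe_add]
    refine mul_le_mul' ((seqNorm_consSeq_le hp _ _).trans ?_)
      ((weakSeqNorm_consSeq_le (one_le_conjExponent p) _ _).trans ?_)
    · rw [seqNorm_const_smul, henorm, add_comm]
      exact add_le_add htu hsv
    · rw [weakSeqNorm_const_smul, henorm, add_comm]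
      exact add_le_add htx hsh
  have hcont : Continuous fun δ : ℝ≥0 => (((c + δ + (d + δ)) ^ 2 : ℝ≥0) : ℝ≥0∞) :=
    ENNReal.continuous_coe.comp (by fun_prop)
  have hlim := (hcont.tendsto 0).mono_left (nhdsWithin_le_nhds (s := Set.Ioi 0))
  simp only [add_zero] at hlim
  refine (ge_of_tendsto hlim ?_).trans (by push_cast; exact le_rfl)
  filter_upwards [self_mem_nhdsWithin] with δ hδ using key δ hδ

theorem latticiallyNuclearNorm_add_sum_smulRight_le {p : ℝ≥0∞} (hp : 1 ≤ p) {κ : Type*}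
    (s : Finset κ) {S : E →L[ℝ] Y} {v : κ → StrongDual ℝ E} {h : κ → Y} (hh : ∀ k, 0 ≤ h k)
    {c : ℝ≥0} {d : κ → ℝ≥0} (hS : latticiallyNuclearNorm p S ≤ c ^ 2)
    (hv : ∀ k, ‖v k‖ₑ * ‖h k‖ₑ ≤ d k ^ 2) :
    latticiallyNuclearNorm p (S + ∑ k ∈ s, (v k).smulRight (h k)) ≤
      ((c + ∑ k ∈ s, d k : ℝ≥0) : ℝ≥0∞) ^ 2 := by
  classical
  induction s using Finset.induction_on with
  | empty => simpa using hS
  | insert a s ha ih =>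
    rw [Finset.sum_insert ha, Finset.sum_insert ha, add_comm (ContinuousLinearMap.smulRight _ _),
      ← add_assoc]
    refine (latticiallyNuclearNorm_add_smulRight_le hp (hh a) ih (hv a)).trans (le_of_eq ?_)
    norm_cast
    ring

end LatticiallyNuclear

/-! ### Transposition exchanges the two nuclear norms -/

section Transposition

/-- A finite-dimensional normed space is isometric to its bidual. -/
def bidualEquiv (G : Type u) [NormedAddCommGroup G] [NormedSpace ℝ G] [FiniteDimensional ℝ G] :
    G ≃ₗᵢ[ℝ] StrongDual ℝ (StrongDual ℝ G) :=
  have h : ∀ (H : Type u) [NormedAddCommGroup H] [NormedSpace ℝ H] [FiniteDimensional ℝ H],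
      Module.finrank ℝ (StrongDual ℝ H) = Module.finrank ℝ H := fun H _ _ _ =>
    (LinearMap.toContinuousLinearMap (𝕜 := ℝ) (E := H) (F' := ℝ)).finrank_eq.symm.trans
      Subspace.dual_finrank_eq
  (NormedSpace.inclusionInDoubleDualLi ℝ).toLinearIsometryEquiv
    ((h G).symm.trans (h (StrongDual ℝ G)).symm)

theorem bidualEquiv_apply {G : Type u} [NormedAddCommGroup G] [NormedSpace ℝ G]
    [FiniteDimensional ℝ G] (x : G) (f : StrongDual ℝ G) : bidualEquiv G x f = f x := rfl

theorem apply_bidualEquiv_symm {G : Type u} [NormedAddCommGroup G] [NormedSpace ℝ G]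
    [FiniteDimensional ℝ G] (w : StrongDual ℝ (StrongDual ℝ G)) (f : StrongDual ℝ G) :
    f ((bidualEquiv G).symm w) = w f := by
  rw [← bidualEquiv_apply, LinearIsometryEquiv.apply_symm_apply]

variable {G : Type u} [NormedAddCommGroup G] [NormedSpace ℝ G] [FiniteDimensional ℝ G]
  {H K : Type u} [NormedAddCommGroup H] [NormedSpace ℝ H] [NormedAddCommGroup K] [NormedSpace ℝ K]

/-- The transpose `H → G** = G → K` of an operator `G* → H*`, composed with an operator `G → K`. -/
def transposeComp (L : G →L[ℝ] K) (V : StrongDual ℝ G →L[ℝ] StrongDual ℝ H) : H →L[ℝ] K :=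
  (L ∘L ((bidualEquiv G).symm.toContinuousLinearEquiv :
    StrongDual ℝ (StrongDual ℝ G) →L[ℝ] G)) ∘L V.flip

theorem transposeComp_apply (L : G →L[ℝ] K) (V : StrongDual ℝ G →L[ℝ] StrongDual ℝ H) (y : H) :
    transposeComp L V y = L ((bidualEquiv G).symm (V.flip y)) := rfl

/-- Transposition is linear and continuous in the operator norm, so it acts term by term, turning
`u_j ⊗ x_j` into `x_j ⊗ L u_j`. -/
theorem hasSum_transposeComp (L : G →L[ℝ] K) {V : StrongDual ℝ G →L[ℝ] StrongDual ℝ H}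
    {u : ℕ → StrongDual ℝ (StrongDual ℝ G)} {x : ℕ → StrongDual ℝ H}
    (h : HasSum (fun j => (u j).smulRight (x j)) V) :
    HasSum (fun j => (x j).smulRight (L ((bidualEquiv G).symm (u j)))) (transposeComp L V) := by
  have h1 := (((ContinuousLinearMap.compL ℝ H (StrongDual ℝ (StrongDual ℝ G)) K) (L ∘L
    ((bidualEquiv G).symm.toContinuousLinearEquiv : StrongDual ℝ (StrongDual ℝ G) →L[ℝ] G))) ∘L
    ((ContinuousLinearMap.flipₗᵢ ℝ (StrongDual ℝ G) H ℝ).toContinuousLinearEquiv :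
      (StrongDual ℝ G →L[ℝ] StrongDual ℝ H) →L[ℝ] _)).hasSum h
  have h3 : (fun j => (x j).smulRight (L ((bidualEquiv G).symm (u j)))) =
      fun j => transposeComp L ((u j).smulRight (x j)) := by
    ext j y
    have h2 : ((u j).smulRight (x j)).flip y = x j y • u j := by
      ext g
      simp [mul_comm]
    rw [transposeComp_apply, h2, map_smul, map_smul, ContinuousLinearMap.smulRight_apply]
  rw [h3]
  exact h1

theorem norm_apply_bidualEquiv_symm_le {L : G →L[ℝ] K} (hL : ‖L‖ ≤ 1)
    (w : StrongDual ℝ (StrongDual ℝ G)) : ‖L ((bidualEquiv G).symm w)‖ ≤ ‖w‖ := by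
  refine (L.le_opNorm _).trans ?_
  rw [LinearIsometryEquiv.norm_map]
  exact mul_le_of_le_one_left (norm_nonneg w) hL

theorem positivelyNuclearNorm_le [Lattice H] [IsOrderedAddMonoid H] {p : ℝ≥0∞} {T : H →L[ℝ] K}
    {f : ℕ → StrongDual ℝ H} {v : ℕ → K} (hT : IsPositivelyNuclearRep p T f v) :
    positivelyNuclearNorm p T ≤ weakSeqNorm (ENNReal.conjExponent p) f * seqNorm p v :=
  iInf_le_of_le f (iInf_le_of_le v (iInf_le _ hT))

theorem positivelyNuclearNorm_transposeComp_le [Lattice H] [HasSolidNorm H] [IsOrderedAddMonoid H]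
    (p : ℝ≥0∞) {L : G →L[ℝ] K} (hL : ‖L‖ ≤ 1) (V : StrongDual ℝ G →L[ℝ] StrongDual ℝ H) :
    positivelyNuclearNorm p (transposeComp L V) ≤ latticiallyNuclearNorm p V := by
  refine le_iInf fun u => le_iInf fun x => le_iInf fun h => ?_
  have hle : seqNorm p (fun j => L ((bidualEquiv G).symm (u j))) ≤ seqNorm p u :=
    seqNorm_mono p fun j => norm_apply_bidualEquiv_symm_le hL (u j)
  have hrep : IsPositivelyNuclearRep p (transposeComp L V) x
      fun j => L ((bidualEquiv G).symm (u j)) :=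
    ⟨h.right_lt_top, hle.trans_lt h.left_lt_top, h.nonneg, hasSum_transposeComp L h.hasSum⟩
  refine (positivelyNuclearNorm_le hrep).trans ?_
  rw [mul_comm]
  exact mul_le_mul' hle le_rfl

/-- Here the positive factors lie in `G**` and are moved to `K`, so `L` must respect positivity
after the identification `G** = G`. -/
theorem latticiallyNuclearNorm_transposeComp_le [Lattice G] [HasSolidNorm G]
    [IsOrderedAddMonoid G] [PartialOrder K] (p : ℝ≥0∞) {L : G →L[ℝ] K} (hL : ‖L‖ ≤ 1)
    (hLpos : ∀ w : StrongDual ℝ (StrongDual ℝ G), 0 ≤ w → 0 ≤ L ((bidualEquiv G).symm w))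
    (V : StrongDual ℝ G →L[ℝ] StrongDual ℝ H) :
    latticiallyNuclearNorm p (transposeComp L V) ≤ positivelyNuclearNorm p V := by
  refine le_iInf fun f => le_iInf fun v => le_iInf fun h => ?_
  have hle : weakSeqNorm (ENNReal.conjExponent p) (fun j => L ((bidualEquiv G).symm (f j))) ≤
      weakSeqNorm (ENNReal.conjExponent p) f :=
    weakSeqNorm_map_le _ (L := L ∘L ((bidualEquiv G).symm.toContinuousLinearEquiv :
      StrongDual ℝ (StrongDual ℝ G) →L[ℝ] G))
      (ContinuousLinearMap.opNorm_le_bound _ zero_le_one fun w => by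
        rw [one_mul]; exact norm_apply_bidualEquiv_symm_le hL w) f
  have hrep : IsLatticiallyNuclearRep p (transposeComp L V) v
      fun j => L ((bidualEquiv G).symm (f j)) :=
    ⟨h.right_lt_top, hle.trans_lt h.left_lt_top, fun j => hLpos _ (h.nonneg j),
      hasSum_transposeComp L h.hasSum⟩
  refine (latticiallyNuclearNorm_le hrep).trans ?_
  rw [mul_comm]
  exact mul_le_mul' hle le_rfl

end Transposition

/-! ### Finite rank operators, adjoints and preadjoints -/

section FiniteRank

variable {E F H : Type u} [NormedAddCommGroup E] [NormedSpace ℝ E] [NormedAddCommGroup F]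
  [NormedSpace ℝ F] [NormedAddCommGroup H] [NormedSpace ℝ H]

theorem isFiniteRank_of_finiteDimensional_left [FiniteDimensional ℝ E] (R : E →L[ℝ] F) :
    IsFiniteRank R :=
  LinearMap.finiteDimensional_range (R : E →ₗ[ℝ] F)

theorem IsFiniteRank.comp_left {R : E →L[ℝ] F} (hR : IsFiniteRank R) (Q : F →L[ℝ] H) :
    IsFiniteRank (Q ∘L R) := by
  have : FiniteDimensional ℝ (LinearMap.range (R : E →ₗ[ℝ] F)) := hR
  have h : LinearMap.range ((Q ∘L R : E →L[ℝ] H) : E →ₗ[ℝ] H) =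
      (LinearMap.range (R : E →ₗ[ℝ] F)).map (Q : F →ₗ[ℝ] H) :=
    LinearMap.range_comp (R : E →ₗ[ℝ] F) (Q : F →ₗ[ℝ] H)
  rw [IsFiniteRank, h]
  infer_instance

theorem IsFiniteRank.comp_right {Q : F →L[ℝ] H} (hQ : IsFiniteRank Q) (R : E →L[ℝ] F) :
    IsFiniteRank (Q ∘L R) := by
  have : FiniteDimensional ℝ (LinearMap.range (Q : F →ₗ[ℝ] H)) := hQ
  refine Submodule.finiteDimensional_of_le (S₂ := LinearMap.range (Q : F →ₗ[ℝ] H)) ?_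
  rintro _ ⟨x, rfl⟩
  exact ⟨R x, rfl⟩

/-- The adjoint factors through the dual of the finite-dimensional range. -/
theorem IsFiniteRank.adj {R : E →L[ℝ] F} (hR : IsFiniteRank R) : IsFiniteRank (adj R) := by
  have : FiniteDimensional ℝ (LinearMap.range (R : E →ₗ[ℝ] F)) := hR
  have h : BanachLatticeOp.adj R = BanachLatticeOp.adj (R.codRestrict
      (LinearMap.range (R : E →ₗ[ℝ] F)) fun x => ⟨x, rfl⟩) ∘L
      BanachLatticeOp.adj (LinearMap.range (R : E →ₗ[ℝ] F)).subtypeL := rfl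
  rw [h]
  exact (isFiniteRank_of_finiteDimensional_left _).comp_right _

theorem norm_adj_le (R : E →L[ℝ] F) : ‖adj R‖ ≤ ‖R‖ :=
  ContinuousLinearMap.opNorm_le_bound _ (norm_nonneg R) fun f => by
    rw [mul_comm]
    exact f.opNorm_comp_le R

/-- The restriction to `H` of the adjoint of an operator `R : F → H*`. -/
def preadj (R : F →L[ℝ] StrongDual ℝ H) : H →L[ℝ] StrongDual ℝ F :=
  adj R ∘L NormedSpace.inclusionInDoubleDual ℝ H

theorem norm_preadj_le (R : F →L[ℝ] StrongDual ℝ H) : ‖preadj R‖ ≤ ‖R‖ :=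
  ((adj R).opNorm_comp_le _).trans <| (mul_le_of_le_one_right (norm_nonneg _)
    (NormedSpace.inclusionInDoubleDual_norm_le ℝ H)).trans (norm_adj_le R)

theorem IsFiniteRank.preadj {R : F →L[ℝ] StrongDual ℝ H} (hR : IsFiniteRank R) :
    IsFiniteRank (preadj R) :=
  hR.adj.comp_right _

end FiniteRank

theorem le_of_forall_pos_le_coe {a : ℝ≥0∞} {f : ℝ≥0 → ℝ≥0} (hf : Continuous f)
    (h : ∀ ε, 0 < ε → a ≤ f ε) : a ≤ f 0 := by
  have hlim := ((ENNReal.continuous_coe.comp hf).tendsto 0).mono_left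
    (nhdsWithin_le_nhds (s := Set.Ioi 0))
  refine ge_of_tendsto hlim ?_
  filter_upwards [self_mem_nhdsWithin] with ε hε using h ε hε

/-! ### Part (a): adjoints of latticially integral operators -/

section LatticiallyToPositively

variable {E X : Type u} [NormedAddCommGroup E] [NormedSpace ℝ E] [NormedAddCommGroup X]
  [NormedSpace ℝ X] [Lattice X] [IsOrderedAddMonoid X]

theorem IsLatticiallyIntegralBound.positivelyNuclearNorm_comp_le {p : ℝ≥0∞} {S : E →L[ℝ] X}
    {C : ℝ≥0} (hS : IsLatticiallyIntegralBound p S C) {G F Y : Type u} [NormedAddCommGroup G]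
    [NormedSpace ℝ G] [FiniteDimensional ℝ G] [NormedAddCommGroup F] [NormedSpace ℝ F]
    [NormedAddCommGroup Y] [NormedSpace ℝ Y] [Lattice Y] [HasSolidNorm Y] [IsOrderedAddMonoid Y]
    {A : Y →L[ℝ] StrongDual ℝ X} (hA : IsFiniteRank A) (hApos : IsPositiveOp A)
    (B : StrongDual ℝ E →L[ℝ] G) {L : G →L[ℝ] F} (hL : ‖L‖ ≤ 1) :
    positivelyNuclearNorm p ((L ∘L B) ∘L adj S ∘L A) ≤ C * ‖B‖ₑ * ‖A‖ₑ := by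
  set Q : Y →L[ℝ] StrongDual ℝ E := BanachLatticeOp.adj S ∘L A with hQ
  have hN : FiniteDimensional ℝ (LinearMap.range (Q : Y →ₗ[ℝ] StrongDual ℝ E)) :=
    hA.comp_left (BanachLatticeOp.adj S)
  have key : ∀ ε : ℝ≥0, 0 < ε → positivelyNuclearNorm p ((L ∘L B) ∘L Q) ≤
      ((C * (‖B‖₊ + ε) * ‖A‖₊ : ℝ≥0) : ℝ≥0∞) := by
    intro ε hε
    obtain ⟨V, hV, hVN⟩ := exists_local_reflexivity (BanachLatticeOp.adj B)
      (LinearMap.range (Q : Y →ₗ[ℝ] StrongDual ℝ E)) (NNReal.coe_pos.2 hε)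
    -- The test space is `G*` and the test lattice is `Y*`; positivity of `preadj A` is that of `A`
    -- with the arguments interchanged.
    have h1 := hS _ _ V (preadj A) (isFiniteRank_of_finiteDimensional_left V) hA.preadj
      fun x hx y hy => hApos y hy x hx
    have h2 : transposeComp L (preadj A ∘L S ∘L V) = (L ∘L B) ∘L Q := by
      ext y
      -- Only the values of `V` paired with the range of `S* A` enter, and there `V` agrees with
      -- `B*` exactly.
      have h3 : (bidualEquiv G).symm ((preadj A ∘L S ∘L V).flip y) = B (Q y) := by
        rw [LinearIsometryEquiv.symm_apply_eq]
        ext g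
        exact hVN g (Q y) ⟨y, rfl⟩
      rw [transposeComp_apply, h3]
      rfl
    have h4 := positivelyNuclearNorm_transposeComp_le p hL (preadj A ∘L S ∘L V)
    rw [h2] at h4
    refine h4.trans (h1.trans ?_)
    rw [enorm_eq_nnnorm, enorm_eq_nnnorm]
    norm_cast
    gcongr
    · exact NNReal.coe_le_coe.1 (hV.trans (by
        push_cast
        gcongr
        exact norm_adj_le B))
    · exact norm_preadj_le A
  have := le_of_forall_pos_le_coe (by fun_prop) key
  simpa [enorm_eq_nnnorm] using this

/-- The adjoint of a latticially `p`-integral operator is positively `p`-integral, with the same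
constants. -/
theorem IsLatticiallyIntegralBound.adj {p : ℝ≥0∞} {S : E →L[ℝ] X} {C : ℝ≥0}
    (hS : IsLatticiallyIntegralBound p S C) : IsPositivelyIntegralBound p (adj S) C := by
  intro Y _ _ _ _ _ _ _ F _ _ _ A B hA hApos hB
  have hBfin : FiniteDimensional ℝ (LinearMap.range (B : StrongDual ℝ E →ₗ[ℝ] F)) := hB
  refine (hS.positivelyNuclearNorm_comp_le hA hApos
    (B.codRestrict (LinearMap.range (B : StrongDual ℝ E →ₗ[ℝ] F)) fun x => ⟨x, rfl⟩)
    (Submodule.norm_subtypeL_le _)).trans ?_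
  gcongr
  exact enorm_le_iff_norm_le.2
    (ContinuousLinearMap.opNorm_le_bound _ (norm_nonneg B) fun x => B.le_opNorm x)

end LatticiallyToPositively

/-! ### The finite-dimensional lattice generated by positive elements -/

section AbsSum

/-- The coordinate space of a family of positive elements `h k` of a Banach lattice, with the
lattice norm `‖a‖ = ‖∑ |a k| • h k‖`. -/
def AbsSumSpace {κ Y : Type u} [Zero Y] [LT Y] (_h : κ → {y : Y // 0 < y}) : Type u := κ → ℝ

variable {κ Y : Type u} [Fintype κ] [NormedAddCommGroup Y] [NormedSpace ℝ Y] [Lattice Y]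
  [HasSolidNorm Y] [IsOrderedAddMonoid Y] [IsOrderedModule ℝ Y] (h : κ → {y : Y // 0 < y})

instance : AddCommGroup (AbsSumSpace h) := inferInstanceAs (AddCommGroup (κ → ℝ))
instance : Module ℝ (AbsSumSpace h) := inferInstanceAs (Module ℝ (κ → ℝ))
instance : Lattice (AbsSumSpace h) := inferInstanceAs (Lattice (κ → ℝ))
instance : IsOrderedAddMonoid (AbsSumSpace h) := inferInstanceAs (IsOrderedAddMonoid (κ → ℝ))
instance : IsOrderedModule ℝ (AbsSumSpace h) := inferInstanceAs (IsOrderedModule ℝ (κ → ℝ))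
instance : FiniteDimensional ℝ (AbsSumSpace h) := inferInstanceAs (FiniteDimensional ℝ (κ → ℝ))

/-- The modulus `∑ |a k| • h k`. -/
def absSum (a : AbsSumSpace h) : Y := ∑ k, |a k| • (h k : Y)

theorem absSum_nonneg (a : AbsSumSpace h) : 0 ≤ absSum h a :=
  Finset.sum_nonneg fun k _ => smul_nonneg (abs_nonneg _) (h k).2.le

theorem absSum_mono {a b : AbsSumSpace h} (hab : ∀ k, |a k| ≤ |b k|) : absSum h a ≤ absSum h b :=
  Finset.sum_le_sum fun k _ => smul_le_smul_of_nonneg_right (hab k) (h k).2.le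

theorem absSum_add_le (a b : AbsSumSpace h) : absSum h (a + b) ≤ absSum h a + absSum h b := by
  rw [absSum, absSum, absSum, ← Finset.sum_add_distrib]
  refine Finset.sum_le_sum fun k _ => ?_
  rw [← add_smul]
  exact smul_le_smul_of_nonneg_right (abs_add_le (a k) (b k)) (h k).2.le

theorem absSum_smul (c : ℝ) (a : AbsSumSpace h) : absSum h (c • a) = |c| • absSum h a := by
  rw [absSum, absSum, Finset.smul_sum]
  refine Finset.sum_congr rfl fun k _ => ?_
  rw [smul_smul, ← abs_mul]
  rfl

instance : Norm (AbsSumSpace h) := ⟨fun a => ‖absSum h a‖⟩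

theorem norm_absSumSpace (a : AbsSumSpace h) : ‖a‖ = ‖absSum h a‖ := rfl

theorem absSumSpace_core : NormedSpace.Core ℝ (AbsSumSpace h) where
  norm_nonneg a := norm_nonneg (absSum h a)
  norm_smul c a := by
    rw [norm_absSumSpace, absSum_smul, norm_smul, norm_absSumSpace, Real.norm_eq_abs,
      Real.norm_eq_abs, abs_abs]
  norm_triangle a b := (norm_le_of_nonneg_of_le (absSum_nonneg h _) (absSum_add_le h a b)).trans
    (norm_add_le _ _)
  norm_eq_zero_iff a := by
    rw [norm_absSumSpace, norm_eq_zero]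
    constructor
    · intro h0
      funext k
      have h1 := (Finset.sum_eq_zero_iff_of_nonneg
        fun k _ => smul_nonneg (abs_nonneg (a k)) (h k).2.le).1 h0 k (Finset.mem_univ k)
      exact abs_eq_zero.1 ((smul_eq_zero.1 h1).resolve_right (h k).2.ne')
    · rintro rfl
      exact Finset.sum_eq_zero fun k _ => by
        change |(0 : ℝ)| • (h k : Y) = 0
        rw [abs_zero, zero_smul]

instance : NormedAddCommGroup (AbsSumSpace h) := NormedAddCommGroup.ofCore (absSumSpace_core h)
instance : NormedSpace ℝ (AbsSumSpace h) := NormedSpace.ofCore (absSumSpace_core h)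
instance : CompleteSpace (AbsSumSpace h) := FiniteDimensional.complete ℝ _

instance : HasSolidNorm (AbsSumSpace h) where
  solid _ _ hab := norm_le_of_nonneg_of_le (X := Y) (absSum_nonneg h _) (absSum_mono h hab)

/-- The standard basis. -/
def absSumBasis : Module.Basis κ ℝ (AbsSumSpace h) := Pi.basisFun ℝ κ

/-- The basis of coordinate functionals. -/
def absSumDualBasis : Module.Basis κ ℝ (StrongDual ℝ (AbsSumSpace h)) :=
  haveI := Classical.decEq κ
  (absSumBasis h).dualBasis.map LinearMap.toContinuousLinearMap

theorem absSumDualBasis_apply (k : κ) (a : AbsSumSpace h) : absSumDualBasis h k a = a k := by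
  classical
  simp only [absSumDualBasis, Module.Basis.map_apply]
  change (absSumBasis h).dualBasis k a = a k
  rw [Module.Basis.coe_dualBasis]
  rfl

theorem absSumDualBasis_repr (g : StrongDual ℝ (AbsSumSpace h)) (k : κ) :
    (absSumDualBasis h).repr g k = g (absSumBasis h k) := by
  classical
  simp only [absSumDualBasis, Module.Basis.map_repr, LinearEquiv.trans_apply]
  exact (absSumBasis h).dualBasis_repr _ k

theorem absSumBasis_nonneg (k : κ) : 0 ≤ absSumBasis h k := by
  classical
  intro j
  have : absSumBasis h k = (Pi.single k 1 : κ → ℝ) := Pi.basisFun_apply ℝ κ k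
  rw [this]
  exact (Pi.single_nonneg.2 zero_le_one : (0 : κ → ℝ) ≤ Pi.single k 1) j

/-- The operator `a ↦ ∑ a k • h k`. -/
def absSumToLattice : AbsSumSpace h →L[ℝ] Y :=
  ((absSumBasis h).constr ℝ fun k => (h k : Y)).toContinuousLinearMap

theorem absSumToLattice_apply (a : AbsSumSpace h) :
    absSumToLattice h a = ∑ k, a k • (h k : Y) := by
  change (absSumBasis h).constr ℝ (fun k => (h k : Y)) a = _
  rw [Module.Basis.constr_apply_fintype]
  rfl

theorem norm_absSumToLattice_le : ‖absSumToLattice h‖ ≤ 1 := by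
  refine ContinuousLinearMap.opNorm_le_bound _ zero_le_one fun a => ?_
  rw [one_mul, norm_absSumSpace, absSumToLattice_apply]
  refine norm_le_norm_of_abs_le_abs ?_
  rw [abs_of_nonneg (absSum_nonneg h a)]
  have habs : ∀ k, |a k • (h k : Y)| ≤ |a k| • (h k : Y) := fun k => by
    rw [abs_le', ← neg_smul]
    exact ⟨smul_le_smul_of_nonneg_right (le_abs_self _) (h k).2.le,
      smul_le_smul_of_nonneg_right (neg_le_abs _) (h k).2.le⟩
  rw [abs_le', ← Finset.sum_neg_distrib]
  exact ⟨Finset.sum_le_sum fun k _ => (le_abs_self _).trans (habs k),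
    Finset.sum_le_sum fun k _ => (neg_le_abs _).trans (habs k)⟩

end AbsSum

/-! ### Part (b): adjoints of positively integral operators -/

section PositivelyToLattically

variable {E X : Type u} [NormedAddCommGroup E] [NormedSpace ℝ E] [NormedAddCommGroup X]
  [NormedSpace ℝ X] [Lattice X] [HasSolidNorm X] [IsOrderedAddMonoid X] [IsOrderedModule ℝ X]

/-- The operator `x ↦ (α k x)_k` with values in the coordinate space of `h`. -/
def toAbsSum {κ Z Y : Type u} [Fintype κ] [NormedAddCommGroup Z] [NormedSpace ℝ Z]
    [NormedAddCommGroup Y] [NormedSpace ℝ Y] [Lattice Y] [HasSolidNorm Y] [IsOrderedAddMonoid Y]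
    [IsOrderedModule ℝ Y] (α : κ → StrongDual ℝ Z) (h : κ → {y : Y // 0 < y}) :
    Z →L[ℝ] AbsSumSpace h :=
  ∑ k, (α k).smulRight (absSumBasis h k)

theorem toAbsSum_apply {κ Z Y : Type u} [Fintype κ] [NormedAddCommGroup Z] [NormedSpace ℝ Z]
    [NormedAddCommGroup Y] [NormedSpace ℝ Y] [Lattice Y] [HasSolidNorm Y] [IsOrderedAddMonoid Y]
    [IsOrderedModule ℝ Y] (α : κ → StrongDual ℝ Z) (h : κ → {y : Y // 0 < y}) (z : Z) (k : κ) :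
    toAbsSum α h z k = α k z := by
  have h1 : toAbsSum α h z = ∑ k, α k z • absSumBasis h k := by
    simp [toAbsSum]
  have h2 := (absSumBasis h).repr_sum_self fun k => α k z
  rw [← h1] at h2
  exact congrFun h2 k

/-- Positivity of the `α k` gives `∑ |α k z| • h k ≤ B |z|`, so factoring `B` through the coordinate
lattice costs nothing in norm. -/
theorem norm_toAbsSum_le {κ Z Y : Type u} [Fintype κ] [NormedAddCommGroup Z] [NormedSpace ℝ Z]
    [Lattice Z] [HasSolidNorm Z] [IsOrderedAddMonoid Z] [NormedAddCommGroup Y] [NormedSpace ℝ Y]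
    [Lattice Y] [HasSolidNorm Y] [IsOrderedAddMonoid Y] [IsOrderedModule ℝ Y]
    {α : κ → StrongDual ℝ Z} (hα : ∀ k, 0 ≤ α k) (h : κ → {y : Y // 0 < y}) {B : Z →L[ℝ] Y}
    (hB : ∀ z, B z = ∑ k, α k z • (h k : Y)) : ‖toAbsSum α h‖ ≤ ‖B‖ := by
  refine ContinuousLinearMap.opNorm_le_bound _ (norm_nonneg B) fun z => ?_
  rw [norm_absSumSpace]
  have h1 : absSum h (toAbsSum α h z) ≤ B |z| := by
    rw [hB, absSum]
    refine Finset.sum_le_sum fun k _ => smul_le_smul_of_nonneg_right ?_ (h k).2.le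
    rw [toAbsSum_apply]
    refine (abs_dual_apply_le (α k) z).trans (le_of_eq ?_)
    rw [abs_of_nonneg (hα k)]
  refine (norm_le_of_nonneg_of_le (absSum_nonneg h _) h1).trans ((B.le_opNorm _).trans ?_)
  rw [norm_abs_eq_norm]

theorem IsFiniteRank.exists_eq_sum {F H : Type u} [NormedAddCommGroup F] [NormedSpace ℝ F]
    [NormedAddCommGroup H] [NormedSpace ℝ H] {Q : F →L[ℝ] H} (hQ : IsFiniteRank Q) :
    ∃ (n : ℕ) (u : Fin n → StrongDual ℝ F) (g : Fin n → H), ∀ x, Q x = ∑ i, u i x • g i := by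
  have : FiniteDimensional ℝ (LinearMap.range (Q : F →ₗ[ℝ] H)) := hQ
  let b := Module.finBasis ℝ (LinearMap.range (Q : F →ₗ[ℝ] H))
  refine ⟨_, fun i => (b.coord i).toContinuousLinearMap ∘L
    Q.codRestrict (LinearMap.range (Q : F →ₗ[ℝ] H)) fun x => ⟨x, rfl⟩, fun i => (b i : H),
    fun x => ?_⟩
  have h := congrArg (LinearMap.range (Q : F →ₗ[ℝ] H)).subtype
    (b.sum_repr (Q.codRestrict (LinearMap.range (Q : F →ₗ[ℝ] H)) (fun x => ⟨x, rfl⟩) x))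
  rw [map_sum] at h
  exact h.symm

/-- The estimate for a positive finite rank operator that factors through a finite-dimensional
lattice. -/
theorem IsPositivelyIntegralBound.latticiallyNuclearNorm_le_of_tensor {p : ℝ≥0∞} (hp : 1 ≤ p)
    {T : X →L[ℝ] E} {C : ℝ≥0} (hT : IsPositivelyIntegralBound p T C)
    {F Y : Type u} [NormedAddCommGroup F] [NormedSpace ℝ F] [NormedAddCommGroup Y]
    [NormedSpace ℝ Y] [Lattice Y] [HasSolidNorm Y] [IsOrderedAddMonoid Y] [IsOrderedModule ℝ Y]
    {A : F →L[ℝ] StrongDual ℝ E} (hA : IsFiniteRank A) {κ : Type u} [Fintype κ]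
    {α : κ → StrongDual ℝ (StrongDual ℝ X)} (hα : ∀ k, 0 ≤ α k) (h : κ → {y : Y // 0 < y})
    {B : StrongDual ℝ X →L[ℝ] Y} (hB : ∀ z, B z = ∑ k, α k z • (h k : Y)) :
    latticiallyNuclearNorm p (B ∘L adj T ∘L A) ≤ C * ‖A‖ₑ * ‖B‖ₑ := by
  obtain ⟨n, u, g, hug⟩ := (hA.comp_left (adj T)).exists_eq_sum
  set U : ℝ≥0 := ∑ i, ‖u i‖₊ with hU
  have key : ∀ δ : ℝ≥0, 0 < δ → latticiallyNuclearNorm p (B ∘L adj T ∘L A) ≤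
      (((NNReal.sqrt (C * ‖A‖₊ * (‖B‖₊ + δ)) +
        ∑ k, NNReal.sqrt (δ * U * ‖(h k : Y)‖₊)) ^ 2 : ℝ≥0) : ℝ≥0∞) := by
    intro δ hδ
    -- The adjoint of `toAbsSum α h` maps the coordinate functionals to the positive `α k` in `X**`;
    -- they are replaced by positive elements of `X`, tested on the vectors `g i` that span the
    -- range of `T* A`.
    obtain ⟨V, hVP, hVnorm, hVg⟩ := exists_approx_local_reflexivity (absSumDualBasis h)
      (PointedCone.positive ℝ X) (adj (toAbsSum α h)) (fun k f hf => by
        change 0 ≤ absSumDualBasis h k (toAbsSum α h f)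
        rw [absSumDualBasis_apply, toAbsSum_apply]
        exact hα k f fun x hx => hf x hx) g (NNReal.coe_pos.2 hδ)
    have hVα : ∀ i k, |g i (V (absSumDualBasis h k)) - α k (g i)| ≤ δ := fun i k => by
      have h1 := hVg i k
      rw [adj_apply, absSumDualBasis_apply, toAbsSum_apply] at h1
      exact h1
    -- A positive functional on the coordinate lattice is a nonnegative combination of coordinate
    -- functionals, so positivity on these suffices.
    have hVpos : IsPositiveOp V := fun w hw => by
      rw [← (absSumDualBasis h).sum_repr w, map_sum]
      refine Finset.sum_nonneg fun k _ => ?_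
      rw [map_smul, absSumDualBasis_repr]
      exact smul_nonneg (hw _ (absSumBasis_nonneg h k)) (hVP k)
    have h1 := hT _ _ V (preadj A) (isFiniteRank_of_finiteDimensional_left V) hVpos hA.preadj
    have h2 := latticiallyNuclearNorm_transposeComp_le p (norm_absSumToLattice_le h)
      (fun w hw => by
        rw [absSumToLattice_apply]
        refine Finset.sum_nonneg fun k _ => smul_nonneg ?_ (h k).2.le
        refine le_of_le_of_eq ?_ (absSumDualBasis_apply h k ((bidualEquiv _).symm w))
        rw [apply_bidualEquiv_symm]
        refine hw _ fun a ha => ?_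
        rw [absSumDualBasis_apply]
        exact ha k) (preadj A ∘L T ∘L V)
    have h3 : latticiallyNuclearNorm p (transposeComp (absSumToLattice h) (preadj A ∘L T ∘L V)) ≤
        (NNReal.sqrt (C * ‖A‖₊ * (‖B‖₊ + δ)) : ℝ≥0∞) ^ 2 := by
      refine h2.trans (h1.trans ?_)
      rw [enorm_eq_nnnorm, enorm_eq_nnnorm]
      norm_cast
      rw [NNReal.sq_sqrt]
      gcongr
      · exact norm_preadj_le A
      · exact NNReal.coe_le_coe.1 (hVnorm.trans (by
          push_cast
          gcongr
          exact (norm_adj_le _).trans (norm_toAbsSum_le hα h hB)))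
    -- The defect of the `k`-th coordinate. It has arbitrary sign, which is harmless since only the
    -- vectors `h k` must be positive.
    set v : κ → StrongDual ℝ F := fun k =>
      (α k - NormedSpace.inclusionInDoubleDual ℝ X (V (absSumDualBasis h k))) ∘L adj T ∘L A
      with hv
    have h4 : B ∘L adj T ∘L A = transposeComp (absSumToLattice h) (preadj A ∘L T ∘L V) +
        ∑ k, (v k).smulRight (h k : Y) := by
      ext f
      have h5 : ∀ k, (bidualEquiv (AbsSumSpace h)).symm ((preadj A ∘L T ∘L V).flip f) k =
          adj T (A f) (V (absSumDualBasis h k)) := fun k => by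
        refine (absSumDualBasis_apply h k _).symm.trans ?_
        rw [apply_bidualEquiv_symm]
        rfl
      simp only [add_apply, sum_apply, ContinuousLinearMap.smulRight_apply, transposeComp_apply,
        absSumToLattice_apply, h5]
      rw [← Finset.sum_add_distrib]
      change B (adj T (A f)) = _
      rw [hB]
      refine Finset.sum_congr rfl fun k _ => ?_
      rw [← add_smul]
      congr 1
      change _ = _ + (α k (adj T (A f)) - adj T (A f) (V (absSumDualBasis h k)))
      ring
    have hvnorm : ∀ k, ‖v k‖ ≤ δ * U := fun k => by
      refine ContinuousLinearMap.opNorm_le_bound _ (by positivity) fun f => ?_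
      have h5 : v k f = ∑ i, u i f * (α k (g i) - g i (V (absSumDualBasis h k))) := by
        change α k ((adj T ∘L A) f) - (adj T ∘L A) f (V (absSumDualBasis h k)) = _
        rw [hug f]
        simp only [map_sum, map_smul, smul_eq_mul, sum_apply, smul_apply, mul_sub,
          Finset.sum_sub_distrib]
      rw [h5, hU]
      push_cast
      rw [Finset.mul_sum, Finset.sum_mul]
      refine norm_sum_le_of_le _ fun i _ => ?_
      rw [norm_mul, mul_comm (δ : ℝ), mul_right_comm]
      refine mul_le_mul ((u i).le_opNorm f) ?_ (norm_nonneg _) (by positivity)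
      rw [Real.norm_eq_abs, abs_sub_comm]
      exact hVα i k
    rw [h4]
    refine (latticiallyNuclearNorm_add_sum_smulRight_le hp Finset.univ (fun k => (h k).2.le) h3
      (d := fun k => NNReal.sqrt (δ * U * ‖(h k : Y)‖₊)) fun k => ?_).trans (by push_cast; rfl)
    rw [enorm_eq_nnnorm, enorm_eq_nnnorm]
    norm_cast
    rw [NNReal.sq_sqrt]
    gcongr
    exact hvnorm k
  have := le_of_forall_pos_le_coe (by fun_prop) key
  simpa [enorm_eq_nnnorm] using this

/-- The adjoint of a positively `p`-integral operator is latticially `p`-integral, with the same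
constants. No approximation property is needed: positive finite rank operators into a Banach lattice
are already approximable through finite-dimensional lattices. -/
theorem IsPositivelyIntegralBound.adj {p : ℝ≥0∞} (hp : 1 ≤ p) {T : X →L[ℝ] E} {C : ℝ≥0}
    (hT : IsPositivelyIntegralBound p T C) : IsLatticiallyIntegralBound p (adj T) C := by
  intro F _ _ _ Y _ _ _ _ _ _ _ A B hA hB hBpos
  obtain ⟨φ, e, -, he, hdec⟩ := exists_positive_tensor_decomposition hB hBpos
  set v : StrongDual ℝ F := φ ∘L BanachLatticeOp.adj T ∘L A with hv
  have key : ∀ ε : ℝ≥0, 0 < ε → latticiallyNuclearNorm p (B ∘L BanachLatticeOp.adj T ∘L A) ≤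
      (((NNReal.sqrt (C * ‖A‖₊ * (‖B‖₊ + ε * ‖φ‖₊ * ‖e‖₊)) +
        NNReal.sqrt (ε * ‖v‖₊ * ‖e‖₊)) ^ 2 : ℝ≥0) : ℝ≥0∞) := by
    intro ε hε
    obtain ⟨κ, _, α, h, hα, hh, hsum⟩ := hdec ε (NNReal.coe_pos.2 hε)
    set D : StrongDual ℝ X →L[ℝ] Y := B + ((ε : ℝ) • φ).smulRight e with hD
    have h1 := hT.latticiallyNuclearNorm_le_of_tensor hp hA hα (fun k => ⟨h k, hh k⟩) (B := D)
      fun z => (hsum z).symm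
    have hDnorm : ‖D‖₊ ≤ ‖B‖₊ + ε * ‖φ‖₊ * ‖e‖₊ := by
      refine (nnnorm_add_le _ _).trans (add_le_add le_rfl (le_of_eq ?_))
      ext
      push_cast
      rw [ContinuousLinearMap.norm_smulRight_apply, norm_smul, Real.norm_of_nonneg (NNReal.coe_nonneg ε)]
    -- Undoing the perturbation subtracts a tensor; the sign goes into the functional, so `e` stays
    -- positive.
    have h2 : B ∘L BanachLatticeOp.adj T ∘L A = D ∘L BanachLatticeOp.adj T ∘L A +
        ((-(ε : ℝ)) • v).smulRight e := by
      ext f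
      change B _ = B _ + ((ε : ℝ) • φ (BanachLatticeOp.adj T (A f))) • e +
        (-(ε : ℝ) • φ (BanachLatticeOp.adj T (A f))) • e
      module
    rw [h2]
    refine (latticiallyNuclearNorm_add_smulRight_le hp he
      (c := NNReal.sqrt (C * ‖A‖₊ * (‖B‖₊ + ε * ‖φ‖₊ * ‖e‖₊)))
      (d := NNReal.sqrt (ε * ‖v‖₊ * ‖e‖₊)) (h1.trans ?_) ?_).trans (by push_cast; rfl)
    · rw [enorm_eq_nnnorm, enorm_eq_nnnorm]
      norm_cast
      rw [NNReal.sq_sqrt]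
      gcongr
    · rw [enorm_smul, enorm_neg, Real.enorm_of_nonneg (NNReal.coe_nonneg ε), enorm_eq_nnnorm, enorm_eq_nnnorm]
      rw [ENNReal.ofReal_coe_nnreal]
      norm_cast
      rw [NNReal.sq_sqrt]
  have := le_of_forall_pos_le_coe (by fun_prop) key
  simpa [enorm_eq_nnnorm] using this

end PositivelyToLattically

theorem IsPositivelyIntegralBound.mono {X E : Type u} [NormedAddCommGroup X] [NormedSpace ℝ X]
    [PartialOrder X] [NormedAddCommGroup E] [NormedSpace ℝ E] {p : ℝ≥0∞} {T : X →L[ℝ] E}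
    {C D : ℝ≥0} (hT : IsPositivelyIntegralBound p T C) (hCD : C ≤ D) :
    IsPositivelyIntegralBound p T D := by
  intro Y _ _ _ _ _ _ _ F _ _ _ A B hA hApos hB
  refine (hT Y F A B hA hApos hB).trans ?_
  gcongr

end BanachLatticeOp

end

theorem corollary1p20 {E X : Type u}
    [NormedAddCommGroup E] [NormedSpace ℝ E] [CompleteSpace E]
    [NormedAddCommGroup X] [NormedSpace ℝ X] [CompleteSpace X] [Lattice X] [HasSolidNorm X]
    [IsOrderedAddMonoid X] [IsOrderedModule ℝ X]
    (p : ENNReal) (hp : 1 ≤ p) :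
    (∀ S : E →L[ℝ] X, BanachLatticeOp.IsLatticiallyIntegral p S →
      BanachLatticeOp.IsPositivelyIntegral p (BanachLatticeOp.adj S) ∧
        BanachLatticeOp.positivelyIntegralNorm p (BanachLatticeOp.adj S) ≤
          BanachLatticeOp.latticiallyIntegralNorm p S) ∧
    (∀ T : X →L[ℝ] E, BanachLatticeOp.IsPositivelyIntegral p T →
      BanachLatticeOp.HasPMAP (StrongDual ℝ X) →
      BanachLatticeOp.IsLatticiallyIntegral p (BanachLatticeOp.adj T) ∧
        BanachLatticeOp.latticiallyIntegralNorm p (BanachLatticeOp.adj T) ≤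
          BanachLatticeOp.positivelyIntegralNorm p T) := by
  -- Positively integral constants must be strictly positive while latticially integral ones may
  -- vanish, hence `C + 1` here and `D + ε` for the norms.
  refine ⟨fun S ⟨C, hC⟩ => ⟨⟨C + 1, by positivity, hC.adj.mono le_self_add⟩, ?_⟩,
    fun T ⟨C, _, hC⟩ _ => ⟨⟨C, hC.adj hp⟩, ?_⟩⟩
  · refine le_iInf₂ fun D hD => ENNReal.le_of_forall_pos_le_add fun ε hε _ => ?_
    refine iInf₂_le_of_le (D + ε) ⟨by positivity, hD.adj.mono le_self_add⟩ ?_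
    push_cast
    exact le_rfl
  · exact le_iInf₂ fun D hD => iInf₂_le D (hD.2.adj hp)
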